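/- **Setting.** Let $A$ (actions, nonempty) and $S$ (outcomes) be finite sets and $\eta>0$. A contractual bandit problem consists of outcome distributions $P(a)\in\Delta(S)$, a reward function $\iota:S\to\mathbb R$ with means $r(a)=P(a)\cdot\iota\in[0,1]$, and agent's costs $c(a)\in[0,1]$ ($a\in A$). Contracts are vectors $x\in\mathcal X=[0,\eta]^S$. In round $t$ the principal posts $x_t\in\mathcal X$; the agent takes an action $a_t\in\arg\max_{a}\{P(a)\cdot x_t-c(a)\}$, given by a best-response function $\beta$ of the contract, $a_t=\beta(x_t)$, whose tie-breaking is arbitrary; an outcome $s_t\sim P(a_t)$ is drawn independently of the past given $a_t$; the principal receives $\iota(s_t)$, pays $x_t(s_t)$, and observes $a_t$, $s_t$ and $\iota(s_t)$. Let $$\mathcal X^a=\{x\in\mathcal X:[P(a)-P(a')]\cdot x\ge c(a)-c(a')\ \ \forall a'\ne a\},\qquad \zeta(a)=\min_{x\in\mathcal X^a}P(a)\cdot x,$$ $$\mathrm{Reg}(T)=\max_{a^*\in A}\sum_{t=1}^T[r(a^*)-\zeta(a^*)]-\sum_{t=1}^T[r(a_t)-P(a_t)\cdot x_t].$$ The problem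 is *$\lambda$-inducible* ($\lambda>0$) if for every $a\in A$ there is $e\in\{0,1\}^S$ with $[P(a)-P(a')]\cdot e\ge\lambda$ for all $a'\neq a$. **Statement.** There is a universal exponent $k\in\mathbb N$ such that the following holds. Let $A,S,\eta,\lambda>0$, a reward bound $B$ and a cost function $c$ (all known to the principal) be given, with $c(a)-c(a')<\lambda\eta$ for all $a,a'\in A$. Then there are a constant $C$ and a learning algorithm (a rule choosing $x_{t}\in\mathcal X$ from the observations of rounds $1,\dots,t-1$, not knowing the horizon), both depending only on $A,S,\eta,\lambda,B,c$, such that for every $\lambda$-inducible contractual bandit problem with cost function $c$ and $|\iota|\le B$ (with $P$ and $\iota$ unknown to the principal), every best-response function $\beta$ and every $T\ge2$, $$\mathbb E[\mathrm{Reg}(T)]\le C\,\sqrt T\,(\log T)^k .$$ That is, with known costs, $\tilde O(\sqrt T)$ expected regret is achieved under $\lambda$-inducibility. -/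

import Mathlib

open scoped Matrix

/-- A contractual bandit problem with finite action set `A` and finite outcome set `S`:
outcome distributions `P a`, noisy reward `reward s` of an outcome, agent's cost `cost a`.
The expected reward and the cost of every action lie in `[0,1]`. -/
structure ContractualBandit (A : Type*) (S : Type*) [Fintype S] where
  P : A → S → ℝ
  reward : S → ℝ
  cost : A → ℝ
  P_mem : ∀ a, P a ∈ stdSimplex ℝ S
  meanReward_mem : ∀ a, P a ⬝ᵥ reward ∈ Set.Icc (0 : ℝ) 1
  cost_mem : ∀ a, cost a ∈ Set.Icc (0 : ℝ) 1

/-- The contracts `x : S → [0, η]`. -/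
def contractSpace (S : Type*) (η : ℝ) : Set (S → ℝ) :=
  {x | ∀ s, x s ∈ Set.Icc 0 η}

/-- What is on record after one round: the posted contract, the agent's action, the outcome and
the principal's reward. -/
structure Round (A : Type*) (S : Type*) where
  contract : S → ℝ
  action : A
  outcome : S
  reward : ℝ

/-- A (deterministic) learning algorithm chooses the next contract from the list of past rounds,
oldest round first. -/
abbrev LearningAlgorithm (A : Type*) (S : Type*) := List (Round A S) → S → ℝ

namespace ContractualBandit

variable {A : Type*} {S : Type*} [Fintype S] (M : ContractualBandit A S)

/-- Expected reward `r a` of the principal when the agent takes action `a`. -/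
def meanReward (a : A) : ℝ := M.P a ⬝ᵥ M.reward

/-- `lam`-inducibility: every action `a` has an event `e ∈ {0,1}^S` whose probability under `a`
exceeds its probability under any other action by at least `lam`. -/
def Inducible (lam : ℝ) : Prop :=
  ∀ a, ∃ e : S → ℝ, (∀ s, e s = 0 ∨ e s = 1) ∧ ∀ a', a' ≠ a → lam ≤ (M.P a - M.P a') ⬝ᵥ e

/-- The contracts under which action `a` is a best response of the agent. -/
def inducingContracts (η : ℝ) (a : A) : Set (S → ℝ) :=
  {x | x ∈ contractSpace S η ∧
    ∀ a', a' ≠ a → M.cost a - M.cost a' ≤ (M.P a - M.P a') ⬝ᵥ x}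

/-- The least expected payment `ζ a` that induces action `a`. -/
noncomputable def leastPayment (η : ℝ) (a : A) : ℝ :=
  sInf ((fun x => M.P a ⬝ᵥ x) '' M.inducingContracts η a)

/-- `β` selects, for every contract, an action that maximizes the agent's expected utility;
ties are broken in an arbitrary way. -/
def IsBestResponse (η : ℝ) (β : (S → ℝ) → A) : Prop :=
  ∀ x ∈ contractSpace S η, ∀ a, M.P a ⬝ᵥ x - M.cost a ≤ M.P (β x) ⬝ᵥ x - M.cost (β x)

/-- Regret of the rounds in `h`, against the best action induced at the least payment. -/
noncomputable def regret (η : ℝ) (h : List (Round A S)) : ℝ :=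
  (⨆ a, (h.map fun _ => M.meanReward a - M.leastPayment η a).sum) -
    (h.map fun ρ => M.meanReward ρ.action - M.P ρ.action ⬝ᵥ ρ.contract).sum

/-- Expectation of `f (history)` after `n` further rounds of play from history `h`: in each round
the algorithm posts `alg h`, the agent answers with `β (alg h)`, and the outcome is drawn from the
distribution of that action, independently of the past. -/
noncomputable def expectAfter (β : (S → ℝ) → A) (alg : LearningAlgorithm A S)
    (f : List (Round A S) → ℝ) : ℕ → List (Round A S) → ℝ
  | 0, h => f h
  | n + 1, h => ∑ s, M.P (β (alg h)) s *
      expectAfter β alg f n (h ++ [⟨alg h, β (alg h), s, M.reward s⟩])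

/-- Expected regret of `T` rounds. -/
noncomputable def expectedRegret (η : ℝ) (β : (S → ℝ) → A) (alg : LearningAlgorithm A S)
    (T : ℕ) : ℝ :=
  M.expectAfter β alg (M.regret η) T []

end ContractualBandit

/-!
The learner is an upper confidence bound algorithm over *plans*: an action, a model `P` that
explains all answers of the agent so far, and a contract that induces the action under `P`. The
true model always explains the answers, so every inducible pair of action and contract is available
as a plan, and choosing the plan of largest upper confidence bound is optimistic.

Since the models consistent with the data differ, the agent may answer the contract of the plan with
another action. The contract posted is therefore shifted slightly towards a base contract that
induces the action under every consistent model with a margin; inducibility provides such contracts,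
after all `{0, η}`-valued contracts have been tried, because a model with a wrong answer at the
average would give a wrong answer at one of them. If the agent still deviates, a bisection of the
segment from the base to the goal locates a contract near which his answer switches, which
determines an incentive `(P a - P a') ⬝ᵥ x` almost exactly for all consistent models, while the
model of the plan is off by a margin. The recorded incentives of one dyadic level thus form an
almost triangular matrix with respect to the models, and a determinant estimate bounds their number
by the dimension `|A| |S|`. Each search takes logarithmically many rounds and there are
logarithmically many levels.

The confidence bounds come from exponential supermartingales, and the widths of the confidence
intervals sum to order `√T` up to logarithms.
-/

section TriangularPerturbation

variable {ι 𝕜 : Type*}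

theorem exists_apply_lt_of_ne_one [Finite ι] [LinearOrder ι] {σ : Equiv.Perm ι} (hσ : σ ≠ 1) :
    ∃ i, σ i < i := by
  cases nonempty_fintype ι
  by_contra! hle
  obtain ⟨i, hi, hmax⟩ := σ.support.exists_max_image id
    (Finset.nonempty_iff_ne_empty.2 (Equiv.Perm.support_eq_empty_iff.not.2 hσ))
  rw [Equiv.Perm.mem_support] at hi
  exact (hmax (σ i) (by simpa using hi)).not_gt ((hle i).lt_of_ne' hi)

variable [Field 𝕜] [LinearOrder 𝕜] [IsStrictOrderedRing 𝕜]

theorem abs_det_sub_prod_diag_le [Fintype ι] [LinearOrder ι] {M : Matrix ι ι 𝕜} {ε R : 𝕜}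
    (hε : 0 ≤ ε) (hR : ∀ i j, |M i j| ≤ R) (hup : ∀ i j, i < j → |M i j| ≤ ε) :
    |M.det - ∏ i, M i i| ≤ (Fintype.card ι).factorial * (ε * R ^ (Fintype.card ι - 1)) := by
  have hterm : ∀ σ ∈ Finset.univ.erase (1 : Equiv.Perm ι),
      |Equiv.Perm.sign σ * ∏ i, M (σ i) i| ≤ ε * R ^ (Fintype.card ι - 1) := by
    intro σ hσ
    obtain ⟨i, hi⟩ := exists_apply_lt_of_ne_one (Finset.ne_of_mem_erase hσ)
    have hsign : |((Equiv.Perm.sign σ : ℤ) : 𝕜)| = 1 := by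
      rcases Int.units_eq_one_or (Equiv.Perm.sign σ) with h | h <;> simp [h]
    calc |Equiv.Perm.sign σ * ∏ i, M (σ i) i|
        = |M (σ i) i| * ∏ j ∈ Finset.univ.erase i, |M (σ j) j| := by
          rw [abs_mul, hsign, one_mul, Finset.abs_prod,
            Finset.mul_prod_erase _ (fun j => |M (σ j) j|) (Finset.mem_univ i)]
      _ ≤ ε * ∏ _j ∈ Finset.univ.erase i, R :=
          mul_le_mul (hup _ _ hi)
            (Finset.prod_le_prod (fun _ _ => abs_nonneg _) fun _ _ => hR _ _)
            (Finset.prod_nonneg fun _ _ => abs_nonneg _) hε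
      _ = ε * R ^ (Fintype.card ι - 1) := by simp
  have hnonneg : 0 ≤ ε * R ^ (Fintype.card ι - 1) := by
    rcases isEmpty_or_nonempty ι with _ | ⟨⟨i⟩⟩
    · simpa using hε
    · have := (abs_nonneg _).trans (hR i i)
      positivity
  have hdet : M.det - ∏ i, M i i =
      ∑ σ ∈ Finset.univ.erase (1 : Equiv.Perm ι), Equiv.Perm.sign σ * ∏ i, M (σ i) i := by
    rw [Matrix.det_apply', ← Finset.add_sum_erase _ _ (Finset.mem_univ 1)]
    simp
  calc |M.det - ∏ i, M i i|
      ≤ ∑ σ ∈ Finset.univ.erase (1 : Equiv.Perm ι), |Equiv.Perm.sign σ * ∏ i, M (σ i) i| := by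
        rw [hdet]; exact Finset.abs_sum_le_sum_abs _ _
    _ ≤ ∑ _σ : Equiv.Perm ι, ε * R ^ (Fintype.card ι - 1) :=
        (Finset.sum_le_sum hterm).trans <|
          Finset.sum_le_sum_of_subset_of_nonneg (Finset.erase_subset _ _) fun _ _ _ => hnonneg
    _ = (Fintype.card ι).factorial * (ε * R ^ (Fintype.card ι - 1)) := by
        rw [Finset.sum_const, Finset.card_univ, Fintype.card_perm, nsmul_eq_mul]

theorem det_ne_zero_of_small_upper [Fintype ι] [LinearOrder ι] {M : Matrix ι ι 𝕜} {ε R G : 𝕜}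
    (hε : 0 ≤ ε) (hG : 0 ≤ G) (hR : ∀ i j, |M i j| ≤ R) (hup : ∀ i j, i < j → |M i j| ≤ ε)
    (hdiag : ∀ i, G ≤ M i i)
    (hsmall : (Fintype.card ι).factorial * (ε * R ^ (Fintype.card ι - 1)) < G ^ Fintype.card ι) :
    M.det ≠ 0 := by
  have hprod : G ^ Fintype.card ι ≤ ∏ i, M i i := by
    simpa using Finset.prod_le_prod (s := Finset.univ) (fun _ _ => hG) fun i _ => hdiag i
  have hdist := neg_le_of_abs_le (abs_det_sub_prod_diag_le hε hR hup)
  exact ne_of_gt (by linarith)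

/-- If there were `finrank 𝕜 E + 1` such pairs, the matrix of their pairings would be nonsingular,
although it factors through `E`. -/
theorem le_finrank_of_small_upper {E : Type*} [AddCommGroup E] [Module 𝕜 E] [Module.Finite 𝕜 E]
    {m : ℕ} {φ : Fin m → Module.Dual 𝕜 E} {w : Fin m → E} {ε R G : 𝕜} (hε : 0 ≤ ε) (hG : 0 ≤ G)
    (hR : ∀ i j, |φ j (w i)| ≤ R) (hup : ∀ i j, i < j → |φ j (w i)| ≤ ε)
    (hdiag : ∀ i, G ≤ φ i (w i))
    (hsmall : ((Module.finrank 𝕜 E + 1).factorial : 𝕜) * (ε * R ^ Module.finrank 𝕜 E) <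
      G ^ (Module.finrank 𝕜 E + 1)) :
    m ≤ Module.finrank 𝕜 E := by
  by_contra! hlt
  let e : Fin (Module.finrank 𝕜 E + 1) ↪o Fin m := Fin.castLEOrderEmb hlt
  let M : Matrix (Fin (Module.finrank 𝕜 E + 1)) (Fin (Module.finrank 𝕜 E + 1)) 𝕜 :=
    Matrix.of fun i j => φ (e j) (w (e i))
  have hdet : M.det ≠ 0 :=
    det_ne_zero_of_small_upper hε hG (fun i j => hR (e i) (e j))
      (fun i j hij => hup _ _ (e.lt_iff_lt.2 hij)) (fun i => hdiag (e i)) (by simpa using hsmall)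
  have hind : LinearIndependent 𝕜 (w ∘ e) := by
    refine Fintype.linearIndependent_iff.2 fun c hc => ?_
    refine congrFun (Matrix.eq_zero_of_vecMul_eq_zero hdet (funext fun j => ?_))
    have := congrArg (φ (e j)) hc
    simpa [M, Matrix.vecMul, dotProduct] using this
  have := hind.fintype_card_le_finrank
  simp at this

end TriangularPerturbation

section Models

/-- The number of free parameters of a model of the outcome distributions. -/
noncomputable abbrev modelDim (A S : Type*) : ℕ := Module.finrank ℝ (A → S → ℝ)

variable {A S : Type*}

theorem convex_contractSpace (η : ℝ) : Convex ℝ (contractSpace S η) := by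
  have : contractSpace S η = Set.univ.pi fun _ => Set.Icc 0 η :=
    Set.ext fun _ => Set.mem_univ_pi.symm
  rw [this]
  exact convex_pi fun _ _ => convex_Icc _ _

variable [Fintype S]

/-- The advantage of action `a` over `a'` in expected payment under the contract `x`, as a linear
functional of the outcome distributions. -/
def incentive (a a' : A) (x : S → ℝ) : (A → S → ℝ) →ₗ[ℝ] ℝ where
  toFun Q := (Q a - Q a') ⬝ᵥ x
  map_add' Q Q' := by rw [← add_dotProduct]; congr 1; simp only [Pi.add_apply]; abel
  map_smul' r Q := by simp only [Pi.smul_apply, ← smul_sub, smul_dotProduct, RingHom.id_apply]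

theorem incentive_apply (a a' : A) (x : S → ℝ) (Q : A → S → ℝ) :
    incentive a a' x Q = (Q a - Q a') ⬝ᵥ x := rfl

theorem incentive_self (a : A) (x : S → ℝ) (Q : A → S → ℝ) : incentive a a x Q = 0 := by
  rw [incentive_apply, sub_self, zero_dotProduct]

theorem incentive_swap (a a' : A) (x : S → ℝ) (Q : A → S → ℝ) :
    incentive a a' x Q = -incentive a' a x Q := by
  rw [incentive_apply, incentive_apply, ← neg_dotProduct, neg_sub]

theorem dotProduct_mem_Icc {q x : S → ℝ} {η : ℝ} (hq : q ∈ stdSimplex ℝ S)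
    (hx : x ∈ contractSpace S η) : q ⬝ᵥ x ∈ Set.Icc 0 η :=
  ⟨Finset.sum_nonneg fun s _ => mul_nonneg (hq.1 s) (hx s).1,
    calc q ⬝ᵥ x ≤ ∑ s, q s * η :=
          Finset.sum_le_sum fun s _ => mul_le_mul_of_nonneg_left (hx s).2 (hq.1 s)
      _ = η := by rw [← Finset.sum_mul, hq.2, one_mul]⟩

theorem abs_incentive_le {Q : A → S → ℝ} (hQ : ∀ a, Q a ∈ stdSimplex ℝ S) {x : S → ℝ} {η : ℝ}
    (hx : x ∈ contractSpace S η) (a a' : A) : |incentive a a' x Q| ≤ η := by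
  have ha := dotProduct_mem_Icc (hQ a) hx
  have ha' := dotProduct_mem_Icc (hQ a') hx
  rw [incentive_apply, sub_dotProduct, abs_le]
  constructor <;> linarith [ha.1, ha.2, ha'.1, ha'.2]

theorem abs_incentive_sub_le {Q Q' : A → S → ℝ} (hQ : ∀ a, Q a ∈ stdSimplex ℝ S)
    (hQ' : ∀ a, Q' a ∈ stdSimplex ℝ S) {x : S → ℝ} {η : ℝ} (hx : x ∈ contractSpace S η)
    (a a' : A) : |incentive a a' x (Q - Q')| ≤ 2 * η := by
  rw [map_sub, two_mul]
  exact (abs_sub _ _).trans (add_le_add (abs_incentive_le hQ hx a a')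
    (abs_incentive_le hQ' hx a a'))

open Classical in
/-- The contracts that pay `η` on an event and nothing elsewhere. -/
noncomputable def probes (S : Type*) [Fintype S] (η : ℝ) : Finset (S → ℝ) :=
  Fintype.piFinset fun _ => {0, η}

theorem mem_probes {η : ℝ} {x : S → ℝ} : x ∈ probes S η ↔ ∀ s, x s = 0 ∨ x s = η := by
  simp only [probes, Fintype.mem_piFinset, Finset.mem_insert, Finset.mem_singleton]

theorem probes_subset_contractSpace {η : ℝ} (hη : 0 ≤ η) : ↑(probes S η) ⊆ contractSpace S η := by
  intro x hx s
  rcases mem_probes.1 hx s with h | h <;> simp [h, hη]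

theorem card_probes_pos (S : Type*) [Fintype S] (η : ℝ) : 0 < (probes S η).card :=
  Finset.card_pos.2 ⟨0, mem_probes.2 fun _ => Or.inl rfl⟩

end Models

/-- A candidate policy: the action to be induced, a contract `base` that induces it safely, a model
of the outcome distributions and a contract `goal` that induces it in the model. -/
structure ContractPlan (A S : Type*) where
  target : A
  base : S → ℝ
  model : A → S → ℝ
  goal : S → ℝ

namespace ContractPlan

variable {A S : Type*} (π : ContractPlan A S)

instance [Nonempty A] : Nonempty (ContractPlan A S) :=
  ⟨⟨Classical.arbitrary A, 0, 0, 0⟩⟩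

/-- The contract at parameter `τ` of the segment from the base to the goal. -/
def point (τ : ℝ) : S → ℝ := AffineMap.lineMap π.base π.goal τ

variable {π}

theorem point_zero : π.point 0 = π.base := AffineMap.lineMap_apply_zero _ _

theorem point_mem {η τ : ℝ} (hbase : π.base ∈ contractSpace S η)
    (hgoal : π.goal ∈ contractSpace S η) (hτ : τ ∈ Set.Icc 0 1) : π.point τ ∈ contractSpace S η :=
  (convex_contractSpace η).lineMap_mem hbase hgoal hτ

variable [Fintype S]

theorem dotProduct_point (d : S → ℝ) (τ : ℝ) :
    d ⬝ᵥ π.point τ = (1 - τ) * (d ⬝ᵥ π.base) + τ * (d ⬝ᵥ π.goal) := by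
  simp only [point, AffineMap.lineMap_apply_module, dotProduct_add, dotProduct_smul, smul_eq_mul]

theorem incentive_point (a a' : A) (τ : ℝ) (Q : A → S → ℝ) :
    incentive a a' (π.point τ) Q =
      (1 - τ) * incentive a a' π.base Q + τ * incentive a a' π.goal Q :=
  dotProduct_point _ _

end ContractPlan

section Statistics

variable {A S : Type*}

/-- In round `t`, the distance of the posted contract from the goal of the plan and the accuracy of
the choice of the plan. -/
noncomputable def slack (t : ℕ) : ℝ := 1 / √(t + 1)

theorem slack_pos (t : ℕ) : 0 < slack t := by unfold slack; positivity

theorem slack_le_one (t : ℕ) : slack t ≤ 1 := by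
  unfold slack
  rw [div_le_one (by positivity)]
  exact Real.one_le_sqrt.2 (by simp)

theorem one_sub_slack_mem (t : ℕ) : 1 - slack t ∈ Set.Icc (0 : ℝ) 1 :=
  ⟨sub_nonneg.2 (slack_le_one t), sub_le_self _ (slack_pos t).le⟩

theorem one_div_two_pow_le_slack (t : ℕ) : 1 / (2 : ℝ) ^ (Nat.log 2 (t + 1) + 1) ≤ slack t := by
  have hlog : (t + 1 : ℝ) ≤ 2 ^ (Nat.log 2 (t + 1) + 1) := by
    exact_mod_cast (Nat.lt_pow_succ_log_self one_lt_two (t + 1)).le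
  refine one_div_le_one_div_of_le (by positivity) (hlog.trans' ?_)
  exact Real.sqrt_le_iff.2 ⟨by positivity, le_self_pow₀ (by simp) two_ne_zero⟩

theorem one_div_sqrt_add_one_le (n : ℕ) : 1 / √((n : ℝ) + 1) ≤ 2 * √((n : ℝ) + 1) - 2 * √n := by
  have hsucc : √((n : ℝ) + 1) * √((n : ℝ) + 1) = n + 1 := Real.mul_self_sqrt (by positivity)
  have hself : √(n : ℝ) * √n = n := Real.mul_self_sqrt (by positivity)
  rw [div_le_iff₀ (by positivity)]
  nlinarith [sq_nonneg (√((n : ℝ) + 1) - √n)]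

theorem sum_slack_le (T : ℕ) : ∑ i ∈ Finset.range T, slack i ≤ 2 * √T := by
  induction T with
  | zero => simp
  | succ T ih =>
    rw [Finset.sum_range_succ, Nat.cast_succ]
    have hstep : slack T ≤ 2 * √((T : ℝ) + 1) - 2 * √T := one_div_sqrt_add_one_le T
    linarith

/-- The confidence radius of round `t`, before division by the square root of the number of
observations. -/
noncomputable def confidenceRadius (t : ℕ) : ℝ := 4 * √(Real.log (t + 2))

open Classical in
/-- The number of rounds of `h` with action `a`. -/
noncomputable def actionCount (a : A) (h : List (Round A S)) : ℕ :=
  h.countP fun ρ => ρ.action = a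

open Classical in
/-- The principal's average payoff in the rounds of `h` with action `a`, had the contract been `x`;
dividing by one more than the number of rounds keeps it meaningful when there are none. -/
noncomputable def empiricalUtility (h : List (Round A S)) (a : A) (x : S → ℝ) : ℝ :=
  (h.map fun ρ => if ρ.action = a then ρ.reward - x ρ.outcome else 0).sum / (actionCount a h + 1)

theorem empiricalUtility_le_sum_abs_reward {x : S → ℝ} {η : ℝ} (hx : x ∈ contractSpace S η)
    (h : List (Round A S)) (a : A) :
    empiricalUtility h a x ≤ (h.map fun ρ => |ρ.reward|).sum := by
  classical
  have hle : (h.map fun ρ => if ρ.action = a then ρ.reward - x ρ.outcome else 0).sum ≤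
      (h.map fun ρ => |ρ.reward|).sum := by
    refine List.sum_le_sum fun ρ _ => ?_
    split_ifs
    · linarith [(hx ρ.outcome).1, le_abs_self ρ.reward]
    · exact abs_nonneg _
  have hnonneg : 0 ≤ (h.map fun ρ => |ρ.reward|).sum :=
    List.sum_nonneg (by simp)
  exact div_le_of_le_mul₀ (by positivity) hnonneg
    (hle.trans (le_mul_of_one_le_right hnonneg (by simp)))

end Statistics

/-- What the principal knows in advance: contracts pay at most `eta` and rewards are at most
`rewardBound` in absolute value. -/
structure PublicInfo (A : Type*) where
  eta : ℝ
  lam : ℝ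
  rewardBound : ℝ
  cost : A → ℝ
  lam_pos : 0 < lam
  cost_sub_lt : ∀ a a', cost a - cost a' < lam * eta

namespace PublicInfo

variable {A S : Type*} (p : PublicInfo A)

theorem eta_pos [Nonempty A] : 0 < p.eta := by
  have h := p.cost_sub_lt (Classical.arbitrary A) (Classical.arbitrary A)
  rw [sub_self] at h
  exact pos_of_mul_pos_right h p.lam_pos.le

section Margin

/-- The largest difference between the costs of two actions. -/
noncomputable def costRange : ℝ := ⨆ i : A × A, (p.cost i.1 - p.cost i.2)

/-- The margin required of a base contract: what is left of the largest margin that a probe is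
sure to achieve after averaging over all probes. -/
noncomputable def margin (S : Type*) [Fintype S] : ℝ :=
  (p.lam * p.eta - p.costRange) / (probes S p.eta).card

theorem cost_sub_le_costRange [Finite A] (a a' : A) : p.cost a - p.cost a' ≤ p.costRange :=
  le_ciSup (f := fun i : A × A => p.cost i.1 - p.cost i.2) (Set.finite_range _).bddAbove (a, a')

theorem costRange_lt [Finite A] [Nonempty A] : p.costRange < p.lam * p.eta := by
  obtain ⟨i, hi⟩ := exists_eq_ciSup_of_finite (f := fun i : A × A => p.cost i.1 - p.cost i.2)
  exact hi.symm.trans_lt (p.cost_sub_lt i.1 i.2)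

theorem margin_pos (S : Type*) [Fintype S] [Finite A] [Nonempty A] : 0 < p.margin S :=
  div_pos (sub_pos.2 p.costRange_lt) (Nat.cast_pos.2 (card_probes_pos S p.eta))

theorem cost_sub_add_margin_le (S : Type*) [Fintype S] [Finite A] (a a' : A) :
    p.cost a - p.cost a' + (probes S p.eta).card * p.margin S ≤ p.lam * p.eta := by
  have hcard : ((probes S p.eta).card : ℝ) ≠ 0 := Nat.cast_ne_zero.2 (card_probes_pos S p.eta).ne'
  rw [margin, mul_div_cancel₀ _ hcard]
  linarith [p.cost_sub_le_costRange a a']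

end Margin

section Contracts

variable [Fintype S]

/-- The outcome distributions `Q` are `lam`-inducible and make all actions in `h` best responses:
they belong to the version space of the history `h`. -/
structure IsPlausible (h : List (Round A S)) (Q : A → S → ℝ) : Prop where
  mem_stdSimplex : ∀ a, Q a ∈ stdSimplex ℝ S
  inducible : ∀ a, ∃ e : S → ℝ, (∀ s, e s = 0 ∨ e s = 1) ∧
    ∀ a', a' ≠ a → p.lam ≤ incentive a a' e Q
  bestResponse : ∀ ρ ∈ h, ∀ a',
    p.cost ρ.action - p.cost a' ≤ incentive ρ.action a' ρ.contract Q

/-- The contracts that induce `a` with a margin in all plausible models. -/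
def robustContracts (h : List (Round A S)) (a : A) : Set (S → ℝ) :=
  {x | x ∈ contractSpace S p.eta ∧ ∀ Q, p.IsPlausible h Q → ∀ a', a' ≠ a →
    p.cost a - p.cost a' + p.margin S ≤ incentive a a' x Q}

/-- The plan uses a robust contract and a plausible model, and its goal induces the target in this
model. -/
structure IsAdmissible (h : List (Round A S)) (π : ContractPlan A S) : Prop where
  base_mem : π.base ∈ p.robustContracts h π.target
  plausible : p.IsPlausible h π.model
  goal_mem : π.goal ∈ contractSpace S p.eta
  goal_induces : ∀ a', p.cost π.target - p.cost a' ≤ incentive π.target a' π.goal π.model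

variable {p} {h h' : List (Round A S)} {Q : A → S → ℝ} {a : A}

theorem IsPlausible.of_isPrefix (hQ : p.IsPlausible h' Q) (hh : h <+: h') : p.IsPlausible h Q :=
  ⟨hQ.mem_stdSimplex, hQ.inducible, fun ρ hρ => hQ.bestResponse ρ (hh.subset hρ)⟩

theorem IsPlausible.exists_probe_margin [Finite A] [Nonempty A] (hQ : p.IsPlausible h Q)
    (hprobe : ∀ x ∈ probes S p.eta, ∃ ρ ∈ h, ρ.contract = x) (a : A) :
    ∃ x ∈ probes S p.eta, (∃ ρ ∈ h, ρ.contract = x ∧ ρ.action = a) ∧ ∀ a', a' ≠ a →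
      p.cost a - p.cost a' + (probes S p.eta).card * p.margin S ≤ incentive a a' x Q := by
  obtain ⟨e, he, hlam⟩ := hQ.inducible a
  have hx : p.eta • e ∈ probes S p.eta :=
    mem_probes.2 fun s => (he s).imp (by simp +contextual) (by simp +contextual)
  have hmargin : ∀ a', a' ≠ a → p.cost a - p.cost a' + (probes S p.eta).card * p.margin S ≤
      incentive a a' (p.eta • e) Q := fun a' ha' => by
    refine (p.cost_sub_add_margin_le S a a').trans ?_
    rw [incentive_apply, dotProduct_smul, smul_eq_mul, mul_comm]
    exact mul_le_mul_of_nonneg_left (hlam a' ha') p.eta_pos.le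
  obtain ⟨ρ, hρ, hρx⟩ := hprobe _ hx
  refine ⟨_, hx, ⟨ρ, hρ, hρx, ?_⟩, hmargin⟩
  by_contra hne
  have hbest := hQ.bestResponse ρ hρ a
  rw [hρx, incentive_swap] at hbest
  have hpos := mul_pos (Nat.cast_pos (α := ℝ).2 (card_probes_pos S p.eta)) (p.margin_pos S)
  linarith [hmargin _ hne]

/-- The average of the probes answered by `a`: none of them hurts, and in every plausible model one
of them has a margin. -/
theorem robustContracts_nonempty [Finite A] [Nonempty A] (hQ : p.IsPlausible h Q)
    (hprobe : ∀ x ∈ probes S p.eta, ∃ ρ ∈ h, ρ.contract = x) (a : A) :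
    (p.robustContracts h a).Nonempty := by
  classical
  let E := (probes S p.eta).filter fun x => ∃ ρ ∈ h, ρ.contract = x ∧ ρ.action = a
  obtain ⟨x₀, hx₀, hans₀, -⟩ := hQ.exists_probe_margin hprobe a
  have hcard : (0 : ℝ) < E.card :=
    Nat.cast_pos.2 (Finset.card_pos.2 ⟨x₀, Finset.mem_filter.2 ⟨hx₀, hans₀⟩⟩)
  refine ⟨∑ x ∈ E, (E.card : ℝ)⁻¹ • x, ?_, fun Q hQ a' ha' => ?_⟩
  · refine (convex_contractSpace p.eta).sum_mem (fun _ _ => by positivity) ?_ fun x hx =>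
      probes_subset_contractSpace p.eta_pos.le (Finset.mem_filter.1 hx).1
    rw [Finset.sum_const, nsmul_eq_mul, mul_inv_cancel₀ hcard.ne']
  · obtain ⟨x₁, hx₁, hans₁, hmargin⟩ := hQ.exists_probe_margin hprobe a
    have hnonneg : ∀ x ∈ E, 0 ≤ incentive a a' x Q - (p.cost a - p.cost a') := by
      intro x hx
      obtain ⟨ρ, hρ, rfl, rfl⟩ := (Finset.mem_filter.1 hx).2
      exact sub_nonneg.2 (hQ.bestResponse ρ hρ a')
    have hsum : E.card * p.margin S ≤
        ∑ x ∈ E, (incentive a a' x Q - (p.cost a - p.cost a')) := by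
      have hle := Finset.card_filter_le (probes S p.eta)
        fun x => ∃ ρ ∈ h, ρ.contract = x ∧ ρ.action = a
      have hmul := mul_le_mul_of_nonneg_right (Nat.cast_le (α := ℝ).2 hle) (p.margin_pos S).le
      have hsingle := Finset.single_le_sum hnonneg (Finset.mem_filter.2 ⟨hx₁, hans₁⟩)
      linarith [hmargin a' ha']
    rw [Finset.sum_sub_distrib, Finset.sum_const, nsmul_eq_mul] at hsum
    rw [← Finset.smul_sum, incentive_apply, dotProduct_smul, dotProduct_sum, smul_eq_mul,
      ← div_eq_inv_mul, le_div_iff₀ hcard]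
    simp only [incentive_apply] at hsum
    linarith

theorem IsAdmissible.point_mem {π : ContractPlan A S} (hπ : p.IsAdmissible h π) {τ : ℝ}
    (hτ : τ ∈ Set.Icc 0 1) : π.point τ ∈ contractSpace S p.eta :=
  ContractPlan.point_mem hπ.base_mem.1 hπ.goal_mem hτ

end Contracts

section Optimism

variable [Fintype S]

/-- A bound on the principal's payoff from a round, summed over the outcomes. -/
noncomputable def payoffScale (S : Type*) [Fintype S] : ℝ :=
  Fintype.card S * (p.rewardBound + p.eta)

/-- The confidence width of the empirical utilities of `a`, uniform over all contracts. -/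
noncomputable def width (h : List (Round A S)) (a : A) : ℝ :=
  p.payoffScale S * (confidenceRadius h.length + 1) / √(actionCount a h + 1)

/-- The upper confidence bound for the principal's utility under a plan. -/
noncomputable def index (h : List (Round A S)) (π : ContractPlan A S) : ℝ :=
  empiricalUtility h π.target π.goal + p.width h π.target

/-- The admissible plan `π` almost maximizes the upper confidence bound. -/
structure IsNearOptimal (h : List (Round A S)) (π : ContractPlan A S) : Prop where
  admissible : p.IsAdmissible h π
  index_le : ∀ π', p.IsAdmissible h π' → p.index h π' ≤ p.index h π + slack h.length

theorem bddAbove_index [Finite A] (h : List (Round A S)) :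
    BddAbove (p.index h '' {π | p.IsAdmissible h π}) := by
  obtain ⟨W, hW⟩ := (Set.finite_range (p.width h)).bddAbove
  refine ⟨(h.map fun ρ => |ρ.reward|).sum + W, ?_⟩
  rintro _ ⟨π, hπ, rfl⟩
  exact add_le_add (empiricalUtility_le_sum_abs_reward hπ.goal_mem h π.target) (hW ⟨_, rfl⟩)

theorem exists_isNearOptimal [Finite A] {h : List (Round A S)}
    (hne : ∃ π, p.IsAdmissible h π) : ∃ π, p.IsNearOptimal h π := by
  obtain ⟨_, ⟨π, hπ, rfl⟩, hlt⟩ := exists_lt_of_lt_csSup (Set.Nonempty.image (p.index h) hne)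
    (sub_lt_self (sSup (p.index h '' {π | p.IsAdmissible h π})) (slack_pos h.length))
  refine ⟨π, hπ, fun π' hπ' => ?_⟩
  linarith [le_csSup (p.bddAbove_index h) ⟨π', hπ', rfl⟩]

variable [Nonempty A]

/-- A near-optimal plan; arbitrary when there is no admissible plan. -/
noncomputable def plan (h : List (Round A S)) : ContractPlan A S :=
  Classical.epsilon (p.IsNearOptimal h)

theorem isNearOptimal_plan [Finite A] {h : List (Round A S)} (hne : ∃ π, p.IsAdmissible h π) :
    p.IsNearOptimal h (p.plan h) :=
  Classical.epsilon_spec (p.exists_isNearOptimal hne)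

end Optimism

section Depth

variable [Fintype S]

/-- The number of bisection steps of a search on level `0`, without the dimension; it makes up for
the size of the constants in `factorial_mul_tolerance_lt`. -/
noncomputable def depthOffset (S : Type*) [Fintype S] : ℕ :=
  ⌈((modelDim A S + 1).factorial : ℝ) *
    (2 * p.eta / p.margin S) ^ (modelDim A S + 1)⌉₊

/-- The number of bisection steps of a search on level `k`, that is, of one started in the rounds
`2 ^ k - 1, …, 2 ^ (k + 1) - 2`. -/
noncomputable def depth (S : Type*) [Fintype S] (k : ℕ) : ℕ :=
  (k + 1) * (modelDim A S + 1) + p.depthOffset S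

/-- The precision with which a search on level `k` determines an incentive. -/
noncomputable def tolerance (S : Type*) [Fintype S] (k : ℕ) : ℝ := 2 * p.eta / 2 ^ p.depth S k

theorem depth_mono : Monotone (p.depth S) := fun _ _ hk =>
  Nat.add_le_add_right (Nat.mul_le_mul_right _ (Nat.succ_le_succ hk)) _

theorem tolerance_nonneg [Nonempty A] (k : ℕ) : 0 ≤ p.tolerance S k :=
  div_nonneg (by linarith [p.eta_pos]) (by positivity)

theorem factorial_mul_tolerance_lt [Finite A] [Nonempty A] (k : ℕ) :
    ((modelDim A S + 1).factorial : ℝ) *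
      (p.tolerance S k * (2 * p.eta) ^ modelDim A S) <
        (p.margin S / 2 ^ (k + 1)) ^ (modelDim A S + 1) := by
  have hmargin := p.margin_pos S
  have hoffset : ((modelDim A S + 1).factorial : ℝ) *
      (2 * p.eta / p.margin S) ^ (modelDim A S + 1) < 2 ^ p.depthOffset S :=
    (Nat.le_ceil _).trans_lt (by exact_mod_cast Nat.lt_two_pow_self)
  rw [div_pow, ← mul_div_assoc, div_lt_iff₀ (by positivity)] at hoffset
  calc _ = ((modelDim A S + 1).factorial : ℝ) *
        (2 * p.eta) ^ (modelDim A S + 1) / 2 ^ p.depth S k := by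
        rw [tolerance, pow_succ]; ring
    _ < 2 ^ p.depthOffset S * p.margin S ^ (modelDim A S + 1) /
        2 ^ p.depth S k := by gcongr
    _ = _ := by
        rw [depth, pow_add 2 _ (p.depthOffset S), pow_mul, div_pow, mul_comm (2 ^ _),
          mul_div_mul_right _ _ (by positivity)]

end Depth

end PublicInfo

/-- A bisection on the segment of the plan made after the history `start`. The contract at the
parameter `lo` is known to induce the target, the one at `hi` is known not to. -/
structure Search (A S : Type*) where
  start : List (Round A S)
  lo : ℝ
  hi : ℝ
  steps : ℕ

namespace Search

variable {A S : Type*} (σ : Search A S)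

/-- The dyadic scale of the round in which the search starts. -/
def level : ℕ := Nat.log 2 (σ.start.length + 1)

/-- The parameter of the contract to be posted next. -/
noncomputable def mid : ℝ := (σ.lo + σ.hi) / 2

open Classical in
/-- The search after a bisection step, in which the agent takes action `a` at the midpoint. -/
noncomputable def bisect (target a : A) : Search A S :=
  if a = target then { σ with lo := σ.mid, steps := σ.steps + 1 }
  else { σ with hi := σ.mid, steps := σ.steps + 1 }

end Search

namespace PublicInfo

variable {A S : Type*} [Nonempty A] [Fintype S] (p : PublicInfo A)

section Learner

open Classical in
/-- The search in progress after the round `ρ` that follows the history `h`. A finished search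
spends one last round. -/
noncomputable def nextSearch (h : List (Round A S)) (ρ : Round A S) :
    Option (Search A S) → Option (Search A S)
  | some σ =>
    if σ.steps = p.depth S σ.level then none
    else some (σ.bisect (p.plan σ.start).target ρ.action)
  | none =>
    if h.length < (probes S p.eta).card ∨ ρ.action = (p.plan h).target then none
    else some ⟨h, 0, 1 - slack h.length, 0⟩

/-- The search in progress after a history. -/
noncomputable def search (h : List (Round A S)) : Option (Search A S) :=
  h.reverseRecOn none p.nextSearch

/-- The contract to be posted after a history: first every probe, then the contracts of near-optimal
plans, interrupted by searches. -/
noncomputable def proposal (h : List (Round A S)) : S → ℝ :=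
  match p.search h with
  | some σ => (p.plan σ.start).point σ.mid
  | none => (probes S p.eta).toList.getD h.length ((p.plan h).point (1 - slack h.length))

open Classical in
/-- The learning algorithm. Its proposals are contracts after all histories that can arise, and are
replaced by the zero contract after others. -/
noncomputable def learner : LearningAlgorithm A S := fun h =>
  if p.proposal h ∈ contractSpace S p.eta then p.proposal h else 0

/-- The round `ρ` after the history `h` is spent on a probe or a search, or it starts a search. -/
def IsLost (h : List (Round A S)) (ρ : Round A S) : Prop :=
  h.length < (probes S p.eta).card ∨ (p.search h).isSome ∨ ρ.action ≠ (p.plan h).target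

open Classical in
/-- The number of lost rounds of a history. -/
noncomputable def lostRounds (h : List (Round A S)) : ℕ :=
  h.reverseRecOn 0 fun h ρ n => n + if p.IsLost h ρ then 1 else 0

theorem search_nil : p.search ([] : List (Round A S)) = none :=
  List.reverseRecOn_nil (motive := fun _ => Option (Search A S)) none p.nextSearch

theorem search_concat (h : List (Round A S)) (ρ : Round A S) :
    p.search (h ++ [ρ]) = p.nextSearch h ρ (p.search h) :=
  List.reverseRecOn_concat (motive := fun _ => Option (Search A S)) ρ h none p.nextSearch

theorem lostRounds_nil : p.lostRounds ([] : List (Round A S)) = 0 :=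
  List.reverseRecOn_nil (motive := fun _ => ℕ) 0 _

open Classical in
theorem lostRounds_concat (h : List (Round A S)) (ρ : Round A S) :
    p.lostRounds (h ++ [ρ]) = p.lostRounds h + if p.IsLost h ρ then 1 else 0 :=
  List.reverseRecOn_concat (motive := fun _ => ℕ) ρ h 0 _

theorem search_eq_none_of_length_le {h : List (Round A S)}
    (hlen : h.length ≤ (probes S p.eta).card) : p.search h = none := by
  induction h using List.reverseRecOn with
  | nil => exact p.search_nil
  | append_singleton h ρ ih =>
    rw [List.length_append, List.length_singleton] at hlen
    rw [search_concat, ih (by omega), nextSearch, if_pos (Or.inl (by omega))]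

theorem learner_mem (h : List (Round A S)) : p.learner h ∈ contractSpace S p.eta := by
  unfold learner
  split_ifs with hmem
  · exact hmem
  · exact fun _ => ⟨le_rfl, p.eta_pos.le⟩

variable {p} {h : List (Round A S)}

theorem learner_eq_proposal (hmem : p.proposal h ∈ contractSpace S p.eta) :
    p.learner h = p.proposal h := if_pos hmem

theorem learner_eq_probe (hlen : h.length < (probes S p.eta).toList.length) :
    p.learner h = (probes S p.eta).toList[h.length] := by
  have hprop : p.proposal h = (probes S p.eta).toList[h.length] := by
    rw [proposal, p.search_eq_none_of_length_le (by simpa using hlen.le)]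
    exact List.getD_eq_getElem _ _ hlen
  rw [learner_eq_proposal, hprop]
  rw [hprop]
  exact probes_subset_contractSpace p.eta_pos.le (Finset.mem_toList.1 (List.getElem_mem hlen))

theorem learner_eq_point_mid {σ : Search A S} (hσ : p.search h = some σ)
    (hplan : p.IsAdmissible σ.start (p.plan σ.start)) (hmid : σ.mid ∈ Set.Icc 0 1) :
    p.learner h = (p.plan σ.start).point σ.mid := by
  have hprop : p.proposal h = (p.plan σ.start).point σ.mid := by rw [proposal, hσ]
  rw [learner_eq_proposal, hprop]
  exact hprop ▸ hplan.point_mem hmid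

theorem learner_eq_point (hnone : p.search h = none) (hlen : (probes S p.eta).card ≤ h.length)
    (hplan : p.IsAdmissible h (p.plan h)) :
    p.learner h = (p.plan h).point (1 - slack h.length) := by
  have hprop : p.proposal h = (p.plan h).point (1 - slack h.length) := by
    rw [proposal, hnone]
    exact List.getD_eq_default _ _ (by simpa using hlen)
  rw [learner_eq_proposal, hprop]
  exact hprop ▸ hplan.point_mem (one_sub_slack_mem _)

end Learner

end PublicInfo

namespace ContractualBandit

variable {A S : Type*} [Fintype S] (M : ContractualBandit A S)

/-- The histories that can arise when the algorithm `alg` plays against the best response `β`. -/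
inductive IsHistory (β : (S → ℝ) → A) (alg : LearningAlgorithm A S) : List (Round A S) → Prop
  | nil : IsHistory β alg []
  | concat {h : List (Round A S)} (hh : IsHistory β alg h) (s : S) :
      IsHistory β alg (h ++ [⟨alg h, β (alg h), s, M.reward s⟩])

end ContractualBandit

namespace PublicInfo

variable {A S : Type*} [Fintype S]

/-- The bandit problem `M` and the best response `β` satisfy what the principal knows. -/
structure Fits (p : PublicInfo A) (M : ContractualBandit A S) (β : (S → ℝ) → A) : Prop where
  cost_eq : M.cost = p.cost
  inducible : M.Inducible p.lam
  abs_reward_le : ∀ s, |M.reward s| ≤ p.rewardBound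
  bestResponse : M.IsBestResponse p.eta β

variable [Nonempty A] {p : PublicInfo A} {M : ContractualBandit A S} {β : (S → ℝ) → A}
  {h : List (Round A S)}

theorem Fits.inducingContracts_nonempty (hf : p.Fits M β) (a : A) :
    (M.inducingContracts p.eta a).Nonempty := by
  obtain ⟨e, he, hlam⟩ := hf.inducible a
  refine ⟨p.eta • e, fun s => ?_, fun a' ha' => ?_⟩
  · rcases he s with h | h <;> simp [h, p.eta_pos.le]
  · rw [dotProduct_smul, smul_eq_mul, hf.cost_eq, mul_comm]
    exact (p.cost_sub_lt a a').le.trans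
      (mul_le_mul_of_nonneg_right (hlam a' ha') p.eta_pos.le)

theorem Fits.isPlausible (hf : p.Fits M β) (hh : M.IsHistory β p.learner h) :
    p.IsPlausible h M.P := by
  refine ⟨M.P_mem, hf.inducible, ?_⟩
  induction hh with
  | nil => exact fun ρ hρ => absurd hρ List.not_mem_nil
  | @concat h _ s ih =>
    refine List.forall_mem_append.2 ⟨ih, List.forall_mem_singleton.2 fun a' => ?_⟩
    have hbest := hf.bestResponse _ (p.learner_mem h) a'
    rw [hf.cost_eq] at hbest
    rw [incentive_apply, sub_dotProduct]
    linarith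

theorem exists_probe_of_isHistory (hh : M.IsHistory β p.learner h) :
    ∀ i (hi : i < (probes S p.eta).toList.length), i < h.length →
      ∃ ρ ∈ h, ρ.contract = (probes S p.eta).toList[i] := by
  induction hh with
  | nil => exact fun i _ hlt => absurd hlt (Nat.not_lt_zero i)
  | @concat h _ s ih =>
    intro i hi hlt
    rw [List.length_append, List.length_singleton] at hlt
    rcases Nat.lt_succ_iff_lt_or_eq.1 hlt with hlt | rfl
    · obtain ⟨ρ, hρ, hx⟩ := ih i hi hlt
      exact ⟨ρ, List.mem_append_left _ hρ, hx⟩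
    · exact ⟨_, List.mem_append_right _ (List.mem_singleton_self _), learner_eq_probe hi⟩

variable [Finite A]

theorem Fits.exists_isAdmissible (hf : p.Fits M β) (hh : M.IsHistory β p.learner h)
    (hlen : (probes S p.eta).card ≤ h.length) {a : A} {x : S → ℝ}
    (hx : x ∈ M.inducingContracts p.eta a) :
    ∃ π, p.IsAdmissible h π ∧ π.target = a ∧ π.goal = x := by
  have hprobe : ∀ y ∈ probes S p.eta, ∃ ρ ∈ h, ρ.contract = y := by
    intro y hy
    obtain ⟨i, hi, rfl⟩ := List.getElem_of_mem (Finset.mem_toList.2 hy)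
    exact exists_probe_of_isHistory hh i hi (hi.trans_le (by simpa using hlen))
  have hP := hf.isPlausible hh
  obtain ⟨b, hb⟩ := robustContracts_nonempty hP hprobe a
  refine ⟨⟨a, b, M.P, x⟩, ⟨hb, hP, hx.1, fun a' => ?_⟩, rfl, rfl⟩
  rcases eq_or_ne a' a with rfl | hne
  · rw [sub_self, incentive_self]
  · exact hf.cost_eq ▸ hx.2 a' hne

theorem Fits.isNearOptimal_plan (hf : p.Fits M β) (hh : M.IsHistory β p.learner h)
    (hlen : (probes S p.eta).card ≤ h.length) : p.IsNearOptimal h (p.plan h) := by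
  obtain ⟨x, hx⟩ := hf.inducingContracts_nonempty (Classical.arbitrary A)
  obtain ⟨π, hπ, -⟩ := hf.exists_isAdmissible hh hlen hx
  exact p.isNearOptimal_plan ⟨π, hπ⟩

end PublicInfo

/-- What a finished search leaves behind: its level, the model of its plan, and the incentive that
it determined, as a linear functional of the outcome distributions. -/
structure SearchRecord (A S : Type*) where
  level : ℕ
  model : A → S → ℝ
  feature : Module.Dual ℝ (A → S → ℝ)

namespace PublicInfo

variable {A S : Type*} [Fintype S]

section Ledger

/-- The records `L`, newest first, are consistent with the history `h` and the outcome distributions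
`P`: all plausible models nearly agree with `P` on the recorded features, whereas the recorded
models err on them. -/
structure IsLedger (p : PublicInfo A) (P : A → S → ℝ) (h : List (Round A S))
    (L : List (SearchRecord A S)) : Prop where
  track : ∀ r ∈ L, ∀ Q, p.IsPlausible h Q → |r.feature (Q - P)| ≤ p.tolerance S r.level
  large : ∀ r ∈ L, p.margin S / 2 ^ (r.level + 1) ≤ r.feature (r.model - P)
  abs_feature_le : ∀ r ∈ L, ∀ Q : A → S → ℝ, (∀ a, Q a ∈ stdSimplex ℝ S) →
    |r.feature (Q - P)| ≤ 2 * p.eta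
  model_mem : ∀ r ∈ L, ∀ a, r.model a ∈ stdSimplex ℝ S
  pairwise : L.Pairwise fun r r' => |r'.feature (r.model - P)| ≤ p.tolerance S r'.level
  level_le : ∀ r ∈ L, r.level ≤ Nat.log 2 (h.length + 1)

variable {p : PublicInfo A} {P : A → S → ℝ} {h h' : List (Round A S)} {L : List (SearchRecord A S)}

theorem isLedger_nil : p.IsLedger P h [] := by
  constructor <;> simp

theorem IsLedger.of_isPrefix (hL : p.IsLedger P h L) (hh : h <+: h') : p.IsLedger P h' L :=
  { hL with
    track := fun r hr Q hQ => hL.track r hr Q (hQ.of_isPrefix hh)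
    level_le := fun r hr =>
      (hL.level_le r hr).trans (Nat.log_mono_right (Nat.succ_le_succ hh.length_le)) }

/-- By `pairwise` and `large`, the errors and the features of the records of one level form a nearly
triangular system. -/
theorem IsLedger.length_le [Finite A] [Nonempty A] (hL : p.IsLedger P h L) :
    L.length ≤ modelDim A S * (Nat.log 2 (h.length + 1) + 1) := by
  have hlevel : ∀ k ∈ Finset.range (Nat.log 2 (h.length + 1) + 1),
      (Finset.univ.filter fun i => (L.get i).level = k).card ≤ modelDim A S := by
    intro k _
    let e := (Finset.univ.filter fun i => (L.get i).level = k).orderEmbOfFin rfl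
    have hk : ∀ i, (L.get (e i)).level = k := fun i =>
      (Finset.mem_filter.1 (Finset.orderEmbOfFin_mem _ rfl i)).2
    have hmem : ∀ i, L.get (e i) ∈ L := fun i => L.get_mem _
    refine le_finrank_of_small_upper (φ := fun i => (L.get (e i)).feature)
      (w := fun i => (L.get (e i)).model - P) (p.tolerance_nonneg k)
      (div_nonneg (p.margin_pos S).le (by positivity))
      (fun i j => hL.abs_feature_le _ (hmem j) _ (hL.model_mem _ (hmem i)))
      (fun i j hij => ?_) (fun i => ?_) (p.factorial_mul_tolerance_lt k)
    · simpa only [hk] using List.pairwise_iff_get.1 hL.pairwise _ _ (e.lt_iff_lt.2 hij)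
    · simpa only [hk] using hL.large _ (hmem i)
  simpa using Finset.card_le_mul_card_image_of_maps_to
    (fun i _ => Finset.mem_range_succ_iff.2 (hL.level_le _ (L.get_mem i))) _ hlevel

end Ledger

section Searches

variable [Nonempty A]

/-- The search `σ` is in progress after the history `h`, and it brackets the boundary of the
contracts that induce its target. -/
structure IsValidSearch (p : PublicInfo A) (h : List (Round A S)) (σ : Search A S) : Prop where
  start_isPrefix : σ.start <+: h
  admissible : p.IsAdmissible σ.start (p.plan σ.start)
  lo_nonneg : 0 ≤ σ.lo
  lo_le_hi : σ.lo ≤ σ.hi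
  hi_le : σ.hi ≤ 1 - slack σ.start.length
  sub_mul_le : (σ.hi - σ.lo) * 2 ^ σ.steps ≤ 1
  steps_le : σ.steps ≤ p.depth S σ.level
  induces_lo : ∀ Q, p.IsPlausible h Q → ∀ a', p.cost (p.plan σ.start).target - p.cost a' ≤
    incentive (p.plan σ.start).target a' ((p.plan σ.start).point σ.lo) Q
  deviates_hi : ∃ a', a' ≠ (p.plan σ.start).target ∧ ∀ Q, p.IsPlausible h Q →
    incentive (p.plan σ.start).target a' ((p.plan σ.start).point σ.hi) Q ≤
      p.cost (p.plan σ.start).target - p.cost a'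

variable {p : PublicInfo A} {P : A → S → ℝ} {h : List (Round A S)} {σ : Search A S}
  {L : List (SearchRecord A S)} {ρ : Round A S}

namespace IsValidSearch

theorem hi_mem (hσ : p.IsValidSearch h σ) : σ.hi ∈ Set.Icc 0 1 :=
  ⟨hσ.lo_nonneg.trans hσ.lo_le_hi, hσ.hi_le.trans (one_sub_slack_mem _).2⟩

theorem mid_mem (hσ : p.IsValidSearch h σ) : σ.mid ∈ Set.Icc 0 1 := by
  have hhi := hσ.hi_mem
  constructor <;> unfold Search.mid <;> linarith [hσ.lo_nonneg, hσ.lo_le_hi, hhi.1, hhi.2]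

theorem level_le (hσ : p.IsValidSearch h σ) : σ.level ≤ Nat.log 2 (h.length + 1) :=
  Nat.log_mono_right (Nat.succ_le_succ hσ.start_isPrefix.length_le)

theorem le_incentive_hi (hσ : p.IsValidSearch h σ) (hsteps : σ.steps = p.depth S σ.level)
    {Q : A → S → ℝ} (hQ : p.IsPlausible h Q) (a' : A) :
    p.cost (p.plan σ.start).target - p.cost a' - p.tolerance S σ.level ≤
      incentive (p.plan σ.start).target a' ((p.plan σ.start).point σ.hi) Q := by
  set a := (p.plan σ.start).target
  have hlo := hσ.induces_lo Q hQ a'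
  have hbase := le_of_abs_le (abs_incentive_le hQ.mem_stdSimplex hσ.admissible.base_mem.1 a a')
  have hgoal := neg_le_of_abs_le (abs_incentive_le hQ.mem_stdSimplex hσ.admissible.goal_mem a a')
  have hlength : σ.hi - σ.lo ≤ 1 / 2 ^ p.depth S σ.level := by
    rw [le_div_iff₀ (by positivity)]
    exact hsteps ▸ hσ.sub_mul_le
  have hchange : (σ.hi - σ.lo) * (incentive a a' (p.plan σ.start).base Q -
      incentive a a' (p.plan σ.start).goal Q) ≤ p.tolerance S σ.level :=
    calc _ ≤ (σ.hi - σ.lo) * (2 * p.eta) :=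
          mul_le_mul_of_nonneg_left (by linarith) (sub_nonneg.2 hσ.lo_le_hi)
      _ ≤ 1 / 2 ^ p.depth S σ.level * (2 * p.eta) :=
          mul_le_mul_of_nonneg_right hlength (by linarith [p.eta_pos])
      _ = p.tolerance S σ.level := one_div_mul_eq_div _ _
  rw [ContractPlan.incentive_point] at hlo ⊢
  linarith

theorem model_margin_le [Finite A] (hσ : p.IsValidSearch h σ) {a' : A}
    (ha' : a' ≠ (p.plan σ.start).target) :
    p.cost (p.plan σ.start).target - p.cost a' + p.margin S / 2 ^ (σ.level + 1) ≤
      incentive (p.plan σ.start).target a' ((p.plan σ.start).point σ.hi)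
        (p.plan σ.start).model := by
  have hadm := hσ.admissible
  have hhi := hσ.hi_mem
  have hbase := mul_le_mul_of_nonneg_left (hadm.base_mem.2 _ hadm.plausible a' ha')
    (sub_nonneg.2 hhi.2)
  have hgoal := mul_le_mul_of_nonneg_left (hadm.goal_induces a') hhi.1
  have hslack : 1 / 2 ^ (σ.level + 1) ≤ 1 - σ.hi :=
    (one_div_two_pow_le_slack _).trans (by linarith [hσ.hi_le])
  have hmargin := mul_le_mul_of_nonneg_right hslack (p.margin_pos S).le
  rw [one_div_mul_eq_div] at hmargin
  rw [ContractPlan.incentive_point]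
  linarith

theorem exists_isLedger_cons [Finite A] (hσ : p.IsValidSearch h σ)
    (hsteps : σ.steps = p.depth S σ.level) (hL : p.IsLedger P σ.start L)
    (hP : p.IsPlausible h P) : ∃ r, p.IsLedger P h (r :: L) := by
  obtain ⟨a', ha', hdev⟩ := hσ.deviates_hi
  have hadm := hσ.admissible
  have hLh := hL.of_isPrefix hσ.start_isPrefix
  refine ⟨⟨σ.level, (p.plan σ.start).model,
    incentive (p.plan σ.start).target a' ((p.plan σ.start).point σ.hi)⟩, ?_, ?_, ?_, ?_, ?_, ?_⟩
  · refine List.forall_mem_cons.2 ⟨fun Q hQ => ?_, hLh.track⟩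
    simp only [map_sub]
    rw [abs_le]
    constructor <;> linarith [hdev Q hQ, hdev P hP, hσ.le_incentive_hi hsteps hQ a',
      hσ.le_incentive_hi hsteps hP a']
  · refine List.forall_mem_cons.2 ⟨?_, hLh.large⟩
    simp only [map_sub]
    linarith [hσ.model_margin_le ha', hdev P hP]
  · exact List.forall_mem_cons.2 ⟨fun Q hQ =>
      abs_incentive_sub_le hQ hP.mem_stdSimplex (hadm.point_mem hσ.hi_mem) _ _, hLh.abs_feature_le⟩
  · exact List.forall_mem_cons.2 ⟨hadm.plausible.mem_stdSimplex, hLh.model_mem⟩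
  · exact List.pairwise_cons.2 ⟨fun r hr => hL.track r hr _ hadm.plausible, hLh.pairwise⟩
  · refine List.forall_mem_cons.2 ⟨?_, hLh.level_le⟩
    exact hσ.level_le

theorem bisect (hσ : p.IsValidSearch h σ) (hρ : ρ.contract = (p.plan σ.start).point σ.mid)
    (hsteps : σ.steps ≠ p.depth S σ.level) :
    p.IsValidSearch (h ++ [ρ]) (σ.bisect (p.plan σ.start).target ρ.action) := by
  have hext := List.prefix_append h [ρ]
  have hle := hσ.lo_le_hi
  have hmid : σ.mid = (σ.lo + σ.hi) / 2 := rfl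
  have hwidth := hσ.sub_mul_le
  have hsteps' : σ.steps + 1 ≤ p.depth S σ.level := lt_of_le_of_ne hσ.steps_le hsteps
  have hanswer : ∀ Q, p.IsPlausible (h ++ [ρ]) Q → ∀ a',
      p.cost ρ.action - p.cost a' ≤ incentive ρ.action a' ((p.plan σ.start).point σ.mid) Q :=
    fun Q hQ a' => hρ ▸ hQ.bestResponse ρ (List.mem_append_right _ (List.mem_singleton_self ρ)) a'
  rw [Search.bisect]
  split_ifs with ha
  · exact
      { hσ with
        start_isPrefix := hσ.start_isPrefix.trans hext
        lo_nonneg := by linarith [hσ.lo_nonneg]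
        lo_le_hi := by linarith
        sub_mul_le := by rw [pow_succ, hmid]; linarith
        steps_le := hsteps'
        induces_lo := ha ▸ hanswer
        deviates_hi := hσ.deviates_hi.imp fun _ hdev =>
          ⟨hdev.1, fun Q hQ => hdev.2 Q (hQ.of_isPrefix hext)⟩ }
  · exact
      { hσ with
        start_isPrefix := hσ.start_isPrefix.trans hext
        lo_le_hi := by linarith
        hi_le := by linarith [hσ.hi_le]
        sub_mul_le := by rw [pow_succ, hmid]; linarith
        steps_le := hsteps'
        induces_lo := fun Q hQ => hσ.induces_lo Q (hQ.of_isPrefix hext)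
        deviates_hi := ⟨ρ.action, ha, fun Q hQ => by
          rw [incentive_swap]
          linarith [hanswer Q hQ (p.plan σ.start).target]⟩ }

theorem of_deviation [Finite A] (hplan : p.IsAdmissible h (p.plan h))
    (hρ : ρ.contract = (p.plan h).point (1 - slack h.length))
    (ha : ρ.action ≠ (p.plan h).target) :
    p.IsValidSearch (h ++ [ρ]) ⟨h, 0, 1 - slack h.length, 0⟩ where
  start_isPrefix := List.prefix_append h [ρ]
  admissible := hplan
  lo_nonneg := le_rfl
  lo_le_hi := (one_sub_slack_mem _).1
  hi_le := le_rfl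
  sub_mul_le := by simpa using (slack_pos h.length).le
  steps_le := Nat.zero_le _
  induces_lo Q hQ a' := by
    rw [ContractPlan.point_zero]
    rcases eq_or_ne a' (p.plan h).target with rfl | hne
    · rw [sub_self, incentive_self]
    · linarith [hplan.base_mem.2 Q (hQ.of_isPrefix (List.prefix_append h [ρ])) a' hne,
        p.margin_pos S]
  deviates_hi := ⟨ρ.action, ha, fun Q hQ => by
    have hbest := hQ.bestResponse ρ (List.mem_append_right _ (List.mem_singleton_self ρ))
      (p.plan h).target
    rw [hρ, incentive_swap] at hbest
    linarith⟩

end IsValidSearch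

/-- The searches finished in `h` are on record in `L` and, together with the probes and the search
in progress, account for the lost rounds. The ledger is that of the start of the search in progress,
because the model of its plan is only known to be plausible there. -/
structure IsAccounted (p : PublicInfo A) (P : A → S → ℝ) (h : List (Round A S))
    (L : List (SearchRecord A S)) : Prop where
  ledger : p.IsLedger P ((p.search h).elim h Search.start) L
  valid : ∀ σ, p.search h = some σ → p.IsValidSearch h σ
  lostRounds_le : p.lostRounds h ≤ min h.length (probes S p.eta).card +
    L.length * (p.depth S (Nat.log 2 (h.length + 1)) + 2) +
      (p.search h).elim 0 fun σ => σ.steps + 1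

variable {M : ContractualBandit A S} {β : (S → ℝ) → A}

theorem isAccounted_nil : p.IsAccounted P [] [] where
  ledger := by rw [search_nil]; exact isLedger_nil
  valid σ hσ := by simp [search_nil] at hσ
  lostRounds_le := by simp [lostRounds_nil]

theorem IsAccounted.lostRounds_concat_le (hL : p.IsAccounted P h L) :
    p.lostRounds (h ++ [ρ]) ≤ min (h ++ [ρ]).length (probes S p.eta).card +
      L.length * (p.depth S (Nat.log 2 ((h ++ [ρ]).length + 1)) + 2) +
        ((p.search h).elim 0 fun σ => σ.steps + 1) + 1 := by
  have hlen : h.length ≤ (h ++ [ρ]).length := by simp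
  have hlost : p.lostRounds (h ++ [ρ]) ≤ p.lostRounds h + 1 := by
    rw [lostRounds_concat]; split_ifs <;> omega
  refine hlost.trans (Nat.add_le_add_right (hL.lostRounds_le.trans ?_) 1)
  gcongr
  exact p.depth_mono (Nat.log_mono_right (by gcongr))

theorem IsAccounted.concat_of_quiet (hL : p.IsAccounted P h L) (hnone : p.search h = none)
    (hquiet : h.length < (probes S p.eta).card ∨ ρ.action = (p.plan h).target) :
    p.IsAccounted P (h ++ [ρ]) L := by
  have hnone' : p.search (h ++ [ρ]) = none := by
    rw [search_concat, hnone, nextSearch, if_pos hquiet]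
  refine ⟨?_, by simp [hnone'], ?_⟩
  · have hledger := hL.ledger
    rw [hnone] at hledger
    rw [hnone']
    exact hledger.of_isPrefix (List.prefix_append h [ρ])
  · have hlost := hL.lostRounds_le
    have hdepth : L.length * (p.depth S (Nat.log 2 (h.length + 1)) + 2) ≤
        L.length * (p.depth S (Nat.log 2 (h.length + 1 + 1)) + 2) := by
      gcongr
      exact p.depth_mono (Nat.log_mono_right (by omega))
    rw [hnone, Option.elim_none] at hlost
    rw [lostRounds_concat, hnone', Option.elim_none, List.length_append, List.length_singleton]
    rcases lt_or_ge h.length (probes S p.eta).card with hlen | hlen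
    · split_ifs <;> omega
    · rw [if_neg (by simp [IsLost, hnone, hquiet.resolve_left hlen.not_gt, hlen])]
      omega

theorem IsAccounted.concat_of_deviation [Finite A] (hL : p.IsAccounted P h L)
    (hnone : p.search h = none) (hlen : (probes S p.eta).card ≤ h.length)
    (hplan : p.IsAdmissible h (p.plan h))
    (hρ : ρ.contract = (p.plan h).point (1 - slack h.length)) (ha : ρ.action ≠ (p.plan h).target) :
    p.IsAccounted P (h ++ [ρ]) L := by
  have hsome : p.search (h ++ [ρ]) = some ⟨h, 0, 1 - slack h.length, 0⟩ := by
    rw [search_concat, hnone, nextSearch, if_neg (by simp [ha, hlen])]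
  refine ⟨?_, fun σ hσ => ?_, ?_⟩
  · have hledger := hL.ledger
    rw [hnone] at hledger
    rwa [hsome]
  · obtain rfl := Option.some.inj (hsome.symm.trans hσ)
    exact .of_deviation hplan hρ ha
  · simpa [hnone, hsome] using hL.lostRounds_concat_le (ρ := ρ)

theorem IsAccounted.concat_of_finished [Finite A] (hL : p.IsAccounted P h L)
    (hσ : p.search h = some σ) (hsteps : σ.steps = p.depth S σ.level) (hP : p.IsPlausible h P) :
    ∃ r, p.IsAccounted P (h ++ [ρ]) (r :: L) := by
  have hvalid := hL.valid σ hσ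
  have hnone : p.search (h ++ [ρ]) = none := by
    rw [search_concat, hσ, nextSearch, if_pos hsteps]
  have hledger := hL.ledger
  rw [hσ] at hledger
  obtain ⟨r, hr⟩ := hvalid.exists_isLedger_cons hsteps hledger hP
  refine ⟨r, ?_, by simp [hnone], ?_⟩
  · rw [hnone]
    exact hr.of_isPrefix (List.prefix_append h [ρ])
  · have hlost := hL.lostRounds_concat_le (ρ := ρ)
    have hdepth : p.depth S σ.level ≤ p.depth S (Nat.log 2 ((h ++ [ρ]).length + 1)) :=
      p.depth_mono (hvalid.level_le.trans (Nat.log_mono_right (by simp)))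
    rw [hσ, Option.elim_some] at hlost
    rw [hnone, Option.elim_none, List.length_cons, Nat.succ_mul]
    omega

theorem IsAccounted.concat_of_bisection (hL : p.IsAccounted P h L) (hσ : p.search h = some σ)
    (hsteps : σ.steps ≠ p.depth S σ.level)
    (hρ : ρ.contract = (p.plan σ.start).point σ.mid) : p.IsAccounted P (h ++ [ρ]) L := by
  have hsome : p.search (h ++ [ρ]) = some (σ.bisect (p.plan σ.start).target ρ.action) := by
    rw [search_concat, hσ, nextSearch, if_neg hsteps]
  have hstart : (σ.bisect (p.plan σ.start).target ρ.action).start = σ.start := by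
    rw [Search.bisect]; split_ifs <;> rfl
  have hcount : (σ.bisect (p.plan σ.start).target ρ.action).steps = σ.steps + 1 := by
    rw [Search.bisect]; split_ifs <;> rfl
  refine ⟨?_, fun τ hτ => ?_, ?_⟩
  · have hledger := hL.ledger
    rw [hσ] at hledger
    rwa [hsome, Option.elim_some, hstart]
  · obtain rfl := Option.some.inj (hsome.symm.trans hτ)
    exact (hL.valid σ hσ).bisect hρ hsteps
  · have hlost := hL.lostRounds_concat_le (ρ := ρ)
    rw [hσ, Option.elim_some] at hlost
    rw [hsome, Option.elim_some, hcount]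
    exact hlost

theorem Fits.exists_isAccounted [Finite A] (hf : p.Fits M β) (hh : M.IsHistory β p.learner h) :
    ∃ L, p.IsAccounted M.P h L := by
  induction hh with
  | nil => exact ⟨[], isAccounted_nil⟩
  | @concat h hh s ih =>
    obtain ⟨L, hL⟩ := ih
    rcases hsearch : p.search h with _ | σ
    · by_cases hquiet : h.length < (probes S p.eta).card ∨ β (p.learner h) = (p.plan h).target
      · exact ⟨L, hL.concat_of_quiet hsearch hquiet⟩
      · obtain ⟨hlen, ha⟩ := not_or.1 hquiet
        have hplan := (hf.isNearOptimal_plan hh (not_lt.1 hlen)).admissible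
        exact ⟨L, hL.concat_of_deviation hsearch (not_lt.1 hlen) hplan
          (learner_eq_point hsearch (not_lt.1 hlen) hplan) ha⟩
    · by_cases hsteps : σ.steps = p.depth S σ.level
      · obtain ⟨r, hr⟩ := hL.concat_of_finished hsearch hsteps (hf.isPlausible hh)
        exact ⟨r :: L, hr⟩
      · have hσ := hL.valid σ hsearch
        exact ⟨L, hL.concat_of_bisection hsearch hsteps
          (learner_eq_point_mid hsearch hσ.admissible hσ.mid_mem)⟩

/-- The coefficient of the squared logarithm in the bound on the number of lost rounds. -/
noncomputable def searchFactor (p : PublicInfo A) (S : Type*) [Fintype S] : ℕ :=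
  (modelDim A S + 1) * (modelDim A S + 3 + p.depthOffset S)

theorem Fits.lostRounds_le [Finite A] (hf : p.Fits M β) (hh : M.IsHistory β p.learner h) :
    p.lostRounds h ≤
      (probes S p.eta).card + (Nat.log 2 (h.length + 1) + 1) ^ 2 * p.searchFactor S := by
  obtain ⟨L, hL⟩ := hf.exists_isAccounted hh
  set K := Nat.log 2 (h.length + 1) with hK
  have hanchor : (p.search h).elim h Search.start <+: h := by
    rcases hsearch : p.search h with _ | σ
    · exact List.prefix_rfl
    · exact (hL.valid σ hsearch).start_isPrefix
  have hlength := (hL.ledger.of_isPrefix hanchor).length_le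
  have hlost := hL.lostRounds_le
  rw [← hK] at hlength hlost
  have hopen : ((p.search h).elim 0 fun σ => σ.steps + 1) ≤ p.depth S K + 1 := by
    rcases hsearch : p.search h with _ | σ
    · exact Nat.zero_le _
    · have hσ := hL.valid σ hsearch
      exact Nat.succ_le_succ (hσ.steps_le.trans (p.depth_mono hσ.level_le))
  calc p.lostRounds h
      ≤ (probes S p.eta).card + (L.length + 1) * (p.depth S K + 2) := by
        have := min_le_right h.length (probes S p.eta).card
        rw [Nat.succ_mul]
        omega
    _ ≤ (probes S p.eta).card + (modelDim A S + 1) * (K + 1) *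
        ((K + 1) * (modelDim A S + 3 + p.depthOffset S)) := by
        rw [depth]
        gcongr <;> nlinarith
    _ = _ := by rw [searchFactor]; ring

end Searches

end PublicInfo

namespace ContractualBandit

variable {A S : Type*} [Fintype S] {M : ContractualBandit A S} {β : (S → ℝ) → A}

section Supersolutions

/-- Functions of the history whose conditional expectation after one more round is at most their
value; evaluated along the play they are supermartingales. -/
def IsSupersolution (M : ContractualBandit A S) (β : (S → ℝ) → A) (alg : LearningAlgorithm A S)
    (F : List (Round A S) → ℝ) : Prop :=
  ∀ h, ∑ s, M.P (β (alg h)) s * F (h ++ [⟨alg h, β (alg h), s, M.reward s⟩]) ≤ F h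

namespace IsSupersolution

variable {alg : LearningAlgorithm A S} {F G : List (Round A S) → ℝ}

theorem const (c : ℝ) : M.IsSupersolution β alg fun _ => c := fun h => by
  rw [← Finset.sum_mul, (M.P_mem _).2, one_mul]

theorem add (hF : M.IsSupersolution β alg F) (hG : M.IsSupersolution β alg G) :
    M.IsSupersolution β alg fun h => F h + G h := fun h => by
  simp only [mul_add, Finset.sum_add_distrib]
  exact add_le_add (hF h) (hG h)

theorem const_mul {c : ℝ} (hc : 0 ≤ c) (hF : M.IsSupersolution β alg F) :
    M.IsSupersolution β alg fun h => c * F h := fun h => by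
  simp only [mul_left_comm _ c, ← Finset.mul_sum]
  exact mul_le_mul_of_nonneg_left (hF h) hc

theorem sum {ι : Type*} {s : Finset ι} {F : ι → List (Round A S) → ℝ}
    (hF : ∀ i ∈ s, M.IsSupersolution β alg (F i)) :
    M.IsSupersolution β alg fun h => ∑ i ∈ s, F i h := fun h => by
  simp only [Finset.mul_sum]
  rw [Finset.sum_comm]
  exact Finset.sum_le_sum fun i hi => hF i hi h

theorem comp_take (hF : M.IsSupersolution β alg F) (n : ℕ) :
    M.IsSupersolution β alg fun h => F (h.take n) := fun h => by
  rcases lt_or_ge h.length n with hn | hn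
  · have htake : ∀ ρ : Round A S, (h ++ [ρ]).take n = h ++ [ρ] := fun ρ =>
      List.take_of_length_le (by simpa using hn)
    simp only [htake, List.take_of_length_le hn.le]
    exact hF h
  · simp only [List.take_append_of_le_length hn]
    exact const (F (h.take n)) h

theorem expectAfter_le (hF : M.IsSupersolution β alg F) {f : List (Round A S) → ℝ} (n : ℕ)
    {h : List (Round A S)} (hh : M.IsHistory β alg h)
    (hle : ∀ g, M.IsHistory β alg g → g.length = h.length + n → f g ≤ F g) :
    M.expectAfter β alg f n h ≤ F h := by
  induction n generalizing h with
  | zero => exact hle h hh rfl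
  | succ n ih =>
    refine (Finset.sum_le_sum fun s _ => mul_le_mul_of_nonneg_left
      (ih (hh.concat s) fun g hg hlen => hle g hg ?_) ((M.P_mem _).1 s)).trans (hF h)
    rw [hlen, List.length_append, List.length_singleton]
    omega

end IsSupersolution

end Supersolutions

end ContractualBandit

section Concentration

variable {A S : Type*}

theorem sum_mul_exp_le_exp_sq [Fintype S] {q f : S → ℝ} (hq : q ∈ stdSimplex ℝ S)
    (hf : ∀ s, |f s| ≤ 1) (hmean : q ⬝ᵥ f = 0) {r : ℝ} (hr : |r| ≤ 1) :
    ∑ s, q s * Real.exp (r * f s) ≤ Real.exp (r ^ 2) := by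
  have hexp : ∀ s, Real.exp (r * f s) ≤ 1 + r * f s + r ^ 2 := fun s => by
    have hrf : |r * f s| ≤ 1 := (abs_mul r (f s)).trans_le (mul_le_one₀ hr (abs_nonneg _) (hf s))
    have hsq : (r * f s) ^ 2 ≤ r ^ 2 := by
      rw [mul_pow]
      exact mul_le_of_le_one_right (sq_nonneg r) ((sq_le_one_iff_abs_le_one _).2 (hf s))
    linarith [le_of_abs_le (Real.abs_exp_sub_one_sub_id_le hrf)]
  calc ∑ s, q s * Real.exp (r * f s)
      ≤ ∑ s, q s * (1 + r * f s + r ^ 2) :=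
        Finset.sum_le_sum fun s _ => mul_le_mul_of_nonneg_left (hexp s) (hq.1 s)
    _ = (∑ s, q s) * (1 + r ^ 2) + r * (q ⬝ᵥ f) := by
        rw [dotProduct, Finset.sum_mul, Finset.mul_sum, ← Finset.sum_add_distrib]
        exact Finset.sum_congr rfl fun s _ => by ring
    _ ≤ Real.exp (r ^ 2) := by
        rw [hq.2, hmean]
        linarith [Real.add_one_le_exp (r ^ 2)]

theorem sum_mul_cosh_add_le [Fintype S] {q f : S → ℝ} (hq : q ∈ stdSimplex ℝ S)
    (hf : ∀ s, |f s| ≤ 1) (hmean : q ⬝ᵥ f = 0) {r : ℝ} (hr : |r| ≤ 1) (y : ℝ) :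
    ∑ s, q s * Real.cosh (y + r * f s) ≤ Real.cosh y * Real.exp (r ^ 2) := by
  have hpos := sum_mul_exp_le_exp_sq hq hf hmean hr
  have hneg := sum_mul_exp_le_exp_sq hq hf hmean ((abs_neg r).trans_le hr)
  rw [neg_sq] at hneg
  calc ∑ s, q s * Real.cosh (y + r * f s)
      = (Real.exp y * ∑ s, q s * Real.exp (r * f s) +
          Real.exp (-y) * ∑ s, q s * Real.exp (-r * f s)) / 2 := by
        rw [Finset.mul_sum, Finset.mul_sum, ← Finset.sum_add_distrib, Finset.sum_div]
        refine Finset.sum_congr rfl fun s _ => ?_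
        rw [Real.cosh_eq, neg_add, Real.exp_add, Real.exp_add, neg_mul]
        ring
    _ ≤ (Real.exp y * Real.exp (r ^ 2) + Real.exp (-y) * Real.exp (r ^ 2)) / 2 := by gcongr
    _ = _ := by rw [Real.cosh_eq]; ring

open Classical in
/-- The excess of the number of outcomes `s` over its mean, in the rounds with action `a`. -/
noncomputable def outcomeDeviation (P : A → S → ℝ) (a : A) (s : S) (h : List (Round A S)) : ℝ :=
  (h.map fun ρ => if ρ.action = a then (if ρ.outcome = s then 1 else 0) - P a s else 0).sum

/-- The hyperbolic cosine of `outcomeDeviation`, compensated so that it becomes a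
supermartingale. -/
noncomputable def coshDeviation (P : A → S → ℝ) (a : A) (s : S) (r : ℝ)
    (h : List (Round A S)) : ℝ :=
  Real.cosh (r * outcomeDeviation P a s h) * Real.exp (-(r ^ 2 * actionCount a h))

/-- The outcome frequencies in `h` are within the confidence radius of their means. -/
def IsConcentrated (P : A → S → ℝ) (h : List (Round A S)) : Prop :=
  ∀ a s, |outcomeDeviation P a s h| ≤ confidenceRadius h.length * √(actionCount a h + 1)

/-- The parameter of `coshDeviation` suited to round `t` and to an action taken `n` times. -/
noncomputable def tilt (t n : ℕ) : ℝ := min 1 (confidenceRadius t / (2 * √(n + 1)))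

/-- A supermartingale that is at least `1` after histories of length `t` that are not concentrated,
and small on average. -/
noncomputable def penalty [Fintype A] [Fintype S] (P : A → S → ℝ) (t : ℕ)
    (h : List (Round A S)) : ℝ :=
  2 / ((t : ℝ) + 2) ^ 4 *
    ∑ i : A × S × Fin (t + 1), coshDeviation P i.1 i.2.1 (tilt t i.2.2) h

variable {P : A → S → ℝ} {h : List (Round A S)}

open Classical in
theorem actionCount_concat (a : A) (h : List (Round A S)) (ρ : Round A S) :
    actionCount a (h ++ [ρ]) = actionCount a h + if ρ.action = a then 1 else 0 := by
  simp [actionCount]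

theorem actionCount_le_length (a : A) (h : List (Round A S)) : actionCount a h ≤ h.length :=
  List.countP_le_length

open Classical in
theorem outcomeDeviation_concat (P : A → S → ℝ) (a : A) (s : S) (h : List (Round A S))
    (ρ : Round A S) : outcomeDeviation P a s (h ++ [ρ]) = outcomeDeviation P a s h +
      if ρ.action = a then (if ρ.outcome = s then 1 else 0) - P a s else 0 := by
  simp [outcomeDeviation]

theorem coshDeviation_nonneg (P : A → S → ℝ) (a : A) (s : S) (r : ℝ) (h : List (Round A S)) :
    0 ≤ coshDeviation P a s r h :=
  mul_nonneg (Real.cosh_pos _).le (Real.exp_pos _).le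

theorem confidenceRadius_nonneg (t : ℕ) : 0 ≤ confidenceRadius t := by
  unfold confidenceRadius; positivity

theorem confidenceRadius_mono : Monotone confidenceRadius := fun t t' ht => by
  unfold confidenceRadius; gcongr

theorem abs_tilt_le_one (t n : ℕ) : |tilt t n| ≤ 1 := by
  rw [abs_of_nonneg]
  · exact min_le_left _ _
  · exact le_min zero_le_one (div_nonneg (confidenceRadius_nonneg t) (by positivity))

/-- The choice of `tilt` minimizes the Chernoff bound at the confidence radius. -/
theorem four_mul_log_le_tilt_mul_sub {t n : ℕ} {x : ℝ}
    (hx : confidenceRadius t * √(n + 1) < x) (hxn : x ≤ n) :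
    4 * Real.log (t + 2) ≤ tilt t n * x - tilt t n ^ 2 * n := by
  have hsq : √((n : ℝ) + 1) ^ 2 = n + 1 := Real.sq_sqrt (by positivity)
  have hradius_sq : confidenceRadius t ^ 2 = 16 * Real.log (t + 2) := by
    have hlog : 0 ≤ Real.log ((t : ℝ) + 2) :=
      Real.log_nonneg (by linarith [t.cast_nonneg' (α := ℝ)])
    rw [confidenceRadius, mul_pow, Real.sq_sqrt hlog]
    norm_num
  have hradius := confidenceRadius_nonneg t
  unfold tilt
  set q := √((n : ℝ) + 1)
  have hq : 0 < q := by positivity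
  have hlt : confidenceRadius t < q := by
    by_contra! hle
    linarith [mul_le_mul_of_nonneg_right hle hq.le]
  rw [min_eq_right ((div_le_one (by positivity)).2 (by linarith))]
  calc 4 * Real.log (t + 2)
      = confidenceRadius t / (2 * q) * (confidenceRadius t * q) -
          (confidenceRadius t / (2 * q)) ^ 2 * q ^ 2 := by
        have hcancel : confidenceRadius t / (2 * q) * (confidenceRadius t * q) -
            (confidenceRadius t / (2 * q)) ^ 2 * q ^ 2 = confidenceRadius t ^ 2 / 4 := by
          field_simp
          norm_num
        rw [hcancel, hradius_sq]
        ring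
    _ ≤ _ := by
        rw [hsq]
        gcongr
        linarith

variable [Fintype S]

theorem abs_indicator_sub_le_one {q : S → ℝ} (hq : q ∈ stdSimplex ℝ S) (s s' : S)
    [Decidable (s' = s)] : |(if s' = s then 1 else 0) - q s| ≤ 1 := by
  have hmem := mem_Icc_of_mem_stdSimplex hq s
  rw [abs_le]
  split_ifs <;> constructor <;> linarith [hmem.1, hmem.2]

theorem dotProduct_indicator_sub_eq_zero [DecidableEq S] {q : S → ℝ} (hq : q ∈ stdSimplex ℝ S)
    (s : S) : (q ⬝ᵥ fun s' => (if s' = s then 1 else 0) - q s) = 0 := by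
  simp [dotProduct, mul_sub, ← Finset.sum_mul, hq.2]

theorem abs_outcomeDeviation_le (hP : ∀ a, P a ∈ stdSimplex ℝ S) (a : A) (s : S)
    (h : List (Round A S)) : |outcomeDeviation P a s h| ≤ actionCount a h := by
  classical
  induction h using List.reverseRecOn with
  | nil => simp [outcomeDeviation]
  | append_singleton h ρ ih =>
    rw [actionCount_concat, outcomeDeviation_concat]
    by_cases ha : ρ.action = a
    · rw [if_pos ha, if_pos ha, Nat.cast_add, Nat.cast_one]
      exact (abs_add_le _ _).trans (add_le_add ih (abs_indicator_sub_le_one (hP a) s ρ.outcome))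
    · simpa only [if_neg ha, add_zero] using ih

variable {M : ContractualBandit A S} {β : (S → ℝ) → A}

theorem isSupersolution_coshDeviation (alg : LearningAlgorithm A S) (a : A) (s : S) {r : ℝ}
    (hr : |r| ≤ 1) : M.IsSupersolution β alg (coshDeviation M.P a s r) := by
  classical
  intro h
  simp only [coshDeviation, actionCount_concat, outcomeDeviation_concat]
  by_cases ha : β (alg h) = a
  · have hexp : Real.exp (-(r ^ 2 * (actionCount a h + 1 : ℕ))) =
        Real.exp (-(r ^ 2 * actionCount a h)) * (Real.exp (r ^ 2))⁻¹ := by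
      rw [← Real.exp_neg, ← Real.exp_add]
      push_cast
      ring_nf
    simp only [ha, if_true, mul_add r, ← mul_assoc, ← Finset.sum_mul, hexp]
    rw [← div_eq_mul_inv, div_le_iff₀ (Real.exp_pos _), mul_right_comm]
    exact mul_le_mul_of_nonneg_right (sum_mul_cosh_add_le (M.P_mem a)
      (fun s' => abs_indicator_sub_le_one (M.P_mem a) s s')
      (dotProduct_indicator_sub_eq_zero (M.P_mem a) s) hr _) (Real.exp_pos _).le
  · simp only [ha, if_false, add_zero]
    rw [← Finset.sum_mul, (M.P_mem _).2, one_mul]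

variable [Fintype A]

theorem penalty_nonneg (P : A → S → ℝ) (t : ℕ) (h : List (Round A S)) : 0 ≤ penalty P t h :=
  mul_nonneg (by positivity) (Finset.sum_nonneg fun _ _ => coshDeviation_nonneg _ _ _ _ _)

theorem one_le_penalty (hP : ∀ a, P a ∈ stdSimplex ℝ S) (hh : ¬ IsConcentrated P h) :
    1 ≤ penalty P h.length h := by
  unfold IsConcentrated at hh
  push Not at hh
  obtain ⟨a, s, hdev⟩ := hh
  set t := h.length
  have hcount : actionCount a h < t + 1 := Nat.lt_succ_of_le (actionCount_le_length a h)
  set r := tilt t (actionCount a h)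
  have hcosh : Real.exp (r * |outcomeDeviation P a s h|) ≤
      2 * Real.cosh (r * outcomeDeviation P a s h) := by
    rw [Real.cosh_eq]
    rcases abs_cases (outcomeDeviation P a s h) with ⟨habs, -⟩ | ⟨habs, -⟩ <;> rw [habs]
    · linarith [Real.exp_pos (-(r * outcomeDeviation P a s h))]
    · rw [mul_neg]
      linarith [Real.exp_pos (r * outcomeDeviation P a s h)]
  have hterm : ((t : ℝ) + 2) ^ 4 ≤ 2 * coshDeviation P a s r h :=
    calc ((t : ℝ) + 2) ^ 4 = Real.exp (4 * Real.log (t + 2)) := by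
          rw [mul_comm, Real.exp_mul, Real.exp_log (by positivity)]; norm_cast
      _ ≤ Real.exp (r * |outcomeDeviation P a s h| - r ^ 2 * actionCount a h) :=
          Real.exp_le_exp.2 (four_mul_log_le_tilt_mul_sub hdev (abs_outcomeDeviation_le hP a s h))
      _ = Real.exp (r * |outcomeDeviation P a s h|) * Real.exp (-(r ^ 2 * actionCount a h)) := by
          rw [sub_eq_add_neg, Real.exp_add]
      _ ≤ _ := by
          rw [coshDeviation, ← mul_assoc]
          exact mul_le_mul_of_nonneg_right hcosh (Real.exp_pos _).le
  have hsum := Finset.single_le_sum (s := Finset.univ)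
    (f := fun i : A × S × Fin (t + 1) => coshDeviation P i.1 i.2.1 (tilt t i.2.2) h)
    (fun _ _ => coshDeviation_nonneg _ _ _ _ _) (Finset.mem_univ (a, s, ⟨_, hcount⟩))
  rw [penalty, div_mul_eq_mul_div, one_le_div (by positivity)]
  exact hterm.trans (mul_le_mul_of_nonneg_left hsum zero_le_two)

theorem penalty_nil_le (P : A → S → ℝ) (t : ℕ) :
    penalty P t [] ≤ 2 * Fintype.card A * Fintype.card S * slack t := by
  have hnil : penalty P t [] =
      2 * Fintype.card A * Fintype.card S * ((t + 1) / ((t : ℝ) + 2) ^ 4) := by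
    simp only [penalty, coshDeviation, outcomeDeviation, actionCount, List.map_nil, List.sum_nil,
      List.countP_nil, Nat.cast_zero, mul_zero, neg_zero, Real.exp_zero, Real.cosh_zero,
      Finset.sum_const, Finset.card_univ, Fintype.card_prod, Fintype.card_fin, Nat.cast_mul,
      Nat.cast_add, Nat.cast_one, nsmul_eq_mul, mul_one]
    ring
  have hsqrt : √((t : ℝ) + 1) ≤ t + 2 := Real.sqrt_le_iff.2 ⟨by positivity, by nlinarith⟩
  have hpow : ((t : ℝ) + 1) * √(t + 1) ≤ ((t : ℝ) + 2) ^ 4 :=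
    calc ((t : ℝ) + 1) * √(t + 1) ≤ (t + 2) * (t + 2) := by gcongr; norm_num
      _ = ((t : ℝ) + 2) ^ 2 := by ring
      _ ≤ ((t : ℝ) + 2) ^ 4 := by gcongr <;> linarith [t.cast_nonneg' (α := ℝ)]
  rw [hnil, slack]
  refine mul_le_mul_of_nonneg_left ?_ (by positivity)
  rwa [div_le_div_iff₀ (by positivity) (by positivity), one_mul]

theorem isSupersolution_penalty (alg : LearningAlgorithm A S) (t : ℕ) :
    M.IsSupersolution β alg (penalty M.P t) :=
  .const_mul (by positivity) <| .sum fun _ _ => isSupersolution_coshDeviation alg _ _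
    (abs_tilt_le_one _ _)

end Concentration
section Accumulation

variable {A S : Type*} [Fintype A] [Fintype S]

/-- The sum of the penalties and the slacks of the first `T` rounds of `h`. -/
noncomputable def totalPenalty (P : A → S → ℝ) (T : ℕ) (h : List (Round A S)) : ℝ :=
  ∑ i ∈ Finset.range T, (penalty P i (h.take i) + slack i)

theorem totalPenalty_concat (P : A → S → ℝ) (h : List (Round A S)) (ρ : Round A S) :
    totalPenalty P (h.length + 1) (h ++ [ρ]) =
      totalPenalty P h.length h + (penalty P h.length h + slack h.length) := by
  rw [totalPenalty, Finset.sum_range_succ, List.take_left', totalPenalty]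
  · congr 1
    refine Finset.sum_congr rfl fun i hi => ?_
    rw [List.take_append_of_le_length (Finset.mem_range.1 hi).le]
  · rfl

theorem totalPenalty_nil_le (P : A → S → ℝ) (T : ℕ) :
    totalPenalty P T [] ≤ (2 * Fintype.card A * Fintype.card S + 1) * (2 * √T) :=
  calc totalPenalty P T [] ≤
        ∑ i ∈ Finset.range T, (2 * Fintype.card A * Fintype.card S + 1) * slack i :=
        Finset.sum_le_sum fun i _ => by
          rw [List.take_nil]
          linarith [penalty_nil_le P i]
    _ ≤ _ := by
        rw [← Finset.mul_sum]
        exact mul_le_mul_of_nonneg_left (sum_slack_le T) (by positivity)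

theorem isSupersolution_totalPenalty {M : ContractualBandit A S} {β : (S → ℝ) → A}
    (alg : LearningAlgorithm A S) (T : ℕ) : M.IsSupersolution β alg (totalPenalty M.P T) :=
  .sum fun i _ => ((isSupersolution_penalty alg i).comp_take i).add (.const _)

end Accumulation

section CountPotential

variable {A S : Type*} [Fintype A]

/-- A potential whose increment in a round bounds the confidence width of the action of that round,
up to the confidence radius. -/
noncomputable def countPotential (h : List (Round A S)) : ℝ :=
  ∑ a, 2 * √(actionCount a h)

theorem countPotential_nil : countPotential ([] : List (Round A S)) = 0 := by
  simp [countPotential, actionCount]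

theorem one_div_sqrt_actionCount_add_one_le (h : List (Round A S)) (ρ : Round A S) :
    1 / √((actionCount ρ.action h : ℝ) + 1) ≤ countPotential (h ++ [ρ]) - countPotential h := by
  classical
  have hrest : ∑ b ∈ Finset.univ.erase ρ.action, 2 * √(actionCount b (h ++ [ρ]) : ℝ) =
      ∑ b ∈ Finset.univ.erase ρ.action, 2 * √(actionCount b h : ℝ) :=
    Finset.sum_congr rfl fun b hb => by
      rw [actionCount_concat, if_neg (Finset.ne_of_mem_erase hb).symm, add_zero]
  have hstep := one_div_sqrt_add_one_le (actionCount ρ.action h)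
  rw [countPotential, countPotential, ← Finset.add_sum_erase _ _ (Finset.mem_univ ρ.action),
    ← Finset.add_sum_erase _ _ (Finset.mem_univ ρ.action), hrest, add_sub_add_right_eq_sub,
    actionCount_concat, if_pos rfl, Nat.cast_add_one]
  exact hstep

theorem countPotential_le (h : List (Round A S)) :
    countPotential h ≤ 2 * Fintype.card A * √h.length :=
  calc countPotential h ≤ ∑ _a : A, 2 * √(h.length : ℝ) := by
        unfold countPotential
        gcongr with a
        exact actionCount_le_length a h
    _ = 2 * Fintype.card A * √h.length := by
        rw [Finset.sum_const, Finset.card_univ, nsmul_eq_mul]; ring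

end CountPotential

section LogarithmicBounds

variable {T : ℕ}

theorem one_le_two_mul_log (hT : 2 ≤ T) : 1 ≤ 2 * Real.log T := by
  have hlog : Real.log 2 ≤ Real.log T := Real.log_le_log two_pos (by exact_mod_cast hT)
  linarith [Real.log_two_gt_d9]

theorem log_add_two_le (hT : 2 ≤ T) : Real.log (T + 2) ≤ 2 * Real.log T := by
  have hT' : (2 : ℝ) ≤ T := by exact_mod_cast hT
  calc Real.log (T + 2) ≤ Real.log (T ^ 2) := Real.log_le_log (by positivity) (by nlinarith)
    _ = 2 * Real.log T := by rw [Real.log_pow, Nat.cast_two]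

theorem nat_log_add_one_le (hT : 2 ≤ T) : (Nat.log 2 (T + 1) : ℝ) + 1 ≤ 6 * Real.log T := by
  have hpow : (2 : ℝ) ^ Nat.log 2 (T + 1) ≤ T + 2 := by
    exact_mod_cast (Nat.pow_log_le_self 2 T.succ_ne_zero).trans (Nat.le_succ _)
  have hlog : Nat.log 2 (T + 1) * Real.log 2 ≤ Real.log (T + 2) := by
    rw [← Real.log_pow]
    exact Real.log_le_log (by positivity) hpow
  have hhalf : (Nat.log 2 (T + 1) : ℝ) * (1 / 2) ≤ Nat.log 2 (T + 1) * Real.log 2 :=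
    mul_le_mul_of_nonneg_left (by linarith [Real.log_two_gt_d9]) (Nat.cast_nonneg _)
  linarith [log_add_two_le hT, one_le_two_mul_log hT]

theorem confidenceRadius_add_one_le (hT : 2 ≤ T) :
    confidenceRadius T + 1 ≤ 18 * Real.log T := by
  have hnonneg : 0 ≤ Real.log ((T : ℝ) + 2) :=
    Real.log_nonneg (by linarith [T.cast_nonneg (α := ℝ)])
  have hsqrt : √(Real.log (T + 2)) ≤ Real.log (T + 2) + 1 :=
    Real.sqrt_le_iff.2 ⟨by positivity, by nlinarith⟩
  unfold confidenceRadius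
  linarith [log_add_two_le hT, one_le_two_mul_log hT]

end LogarithmicBounds

theorem abs_dotProduct_le_card_mul {S : Type*} [Fintype S] {v w : S → ℝ} {a b : ℝ}
    (hv : ∀ s, |v s| ≤ a) (hw : ∀ s, |w s| ≤ b) : |v ⬝ᵥ w| ≤ Fintype.card S * (a * b) :=
  calc |v ⬝ᵥ w| ≤ ∑ s, |v s * w s| := Finset.abs_sum_le_sum_abs _ _
    _ ≤ ∑ _s : S, a * b := Finset.sum_le_sum fun s _ => (abs_mul _ _).trans_le
        (mul_le_mul (hv s) (hw s) (abs_nonneg _) ((abs_nonneg _).trans (hv s)))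
    _ = Fintype.card S * (a * b) := by rw [Finset.sum_const, Finset.card_univ, nsmul_eq_mul]

namespace ContractualBandit

variable {A S : Type*} [Fintype S]

/-- The principal's expected utility from action `a` under the contract `x`. -/
noncomputable def utility (M : ContractualBandit A S) (a : A) (x : S → ℝ) : ℝ :=
  M.meanReward a - M.P a ⬝ᵥ x

/-- The principal's utility from inducing `a` at the least payment. -/
noncomputable def inducedValue (M : ContractualBandit A S) (η : ℝ) (a : A) : ℝ :=
  M.meanReward a - M.leastPayment η a

variable {M : ContractualBandit A S} {β : (S → ℝ) → A} {η : ℝ} {a : A} {x : S → ℝ}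

theorem utility_eq_dotProduct (M : ContractualBandit A S) (a : A) (x : S → ℝ) :
    M.utility a x = M.P a ⬝ᵥ (M.reward - x) := by
  rw [utility, meanReward, dotProduct_sub]

theorem utility_mem (a : A) (hx : x ∈ contractSpace S η) : M.utility a x ∈ Set.Icc (-η) 1 := by
  have hpay := dotProduct_mem_Icc (M.P_mem a) hx
  have hreward := M.meanReward_mem a
  unfold utility meanReward
  exact ⟨by linarith [hpay.2, hreward.1], by linarith [hpay.1, hreward.2]⟩

theorem inducedValue_le {b : ℝ} (hne : (M.inducingContracts η a).Nonempty)
    (hb : ∀ x ∈ M.inducingContracts η a, M.utility a x ≤ b) : M.inducedValue η a ≤ b := by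
  refine sub_le_comm.1 (le_csInf (hne.image _) ?_)
  rintro _ ⟨x, hx, rfl⟩
  exact sub_le_comm.1 (hb x hx)

open Classical in
theorem IsHistory.sum_payoff {alg : LearningAlgorithm A S} {h : List (Round A S)}
    (hh : M.IsHistory β alg h) (a : A) (x : S → ℝ) :
    (h.map fun ρ => if ρ.action = a then ρ.reward - x ρ.outcome else 0).sum =
      actionCount a h * M.utility a x +
        (fun s => outcomeDeviation M.P a s h) ⬝ᵥ (M.reward - x) := by
  induction hh with
  | nil => simp [actionCount, outcomeDeviation]
  | @concat h _ s ih =>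
    rw [List.map_append, List.sum_append, ih, actionCount_concat]
    simp only [outcomeDeviation_concat, List.map_cons, List.map_nil, List.sum_singleton]
    split_ifs with ha
    · have hdev : (fun s' => outcomeDeviation M.P a s' h +
          ((if s = s' then 1 else 0) - M.P a s')) ⬝ᵥ (M.reward - x) =
          (fun s' => outcomeDeviation M.P a s' h) ⬝ᵥ (M.reward - x) +
            (M.reward s - x s - M.utility a x) := by
        rw [utility_eq_dotProduct]
        simp [dotProduct, add_mul, sub_mul, Finset.sum_add_distrib, Finset.sum_sub_distrib]
      rw [hdev]
      push_cast
      ring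
    · simp only [add_zero]

theorem IsHistory.empiricalUtility_sub_utility {alg : LearningAlgorithm A S}
    {h : List (Round A S)} (hh : M.IsHistory β alg h) (a : A) (x : S → ℝ) :
    empiricalUtility h a x - M.utility a x =
      ((fun s => outcomeDeviation M.P a s h) ⬝ᵥ (M.reward - x) - M.utility a x) /
        (actionCount a h + 1) := by
  rw [empiricalUtility, hh.sum_payoff]
  field_simp
  ring

end ContractualBandit

namespace PublicInfo

variable {A S : Type*} [Fintype S] {p : PublicInfo A} {M : ContractualBandit A S}
  {β : (S → ℝ) → A} {h : List (Round A S)} {a : A} {x : S → ℝ}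

section Confidence

theorem Fits.abs_reward_sub_le (hf : p.Fits M β) (hx : x ∈ contractSpace S p.eta) (s : S) :
    |(M.reward - x) s| ≤ p.rewardBound + p.eta := by
  have hreward := abs_le.1 (hf.abs_reward_le s)
  have hpay := hx s
  rw [Pi.sub_apply, abs_le]
  constructor <;> linarith [hreward.1, hreward.2, hpay.1, hpay.2]

theorem Fits.abs_utility_le (hf : p.Fits M β) (a : A) (hx : x ∈ contractSpace S p.eta) :
    |M.utility a x| ≤ p.payoffScale S := by
  have hP : ∀ s, |M.P a s| ≤ 1 := fun s =>
    abs_le.2 ⟨by linarith [(M.P_mem a).1 s], (mem_Icc_of_mem_stdSimplex (M.P_mem a) s).2⟩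
  rw [M.utility_eq_dotProduct, payoffScale, ← one_mul (p.rewardBound + p.eta)]
  exact abs_dotProduct_le_card_mul hP (hf.abs_reward_sub_le hx)

variable [Nonempty A]

theorem Fits.payoffScale_nonneg (hf : p.Fits M β) : 0 ≤ p.payoffScale S :=
  (abs_nonneg _).trans (hf.abs_utility_le (Classical.arbitrary A) (p.learner_mem []))

theorem Fits.abs_empiricalUtility_sub_le (hf : p.Fits M β) (hh : M.IsHistory β p.learner h)
    (hconc : IsConcentrated M.P h) (a : A) (hx : x ∈ contractSpace S p.eta) :
    |empiricalUtility h a x - M.utility a x| ≤ p.width h a := by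
  have hscale := hf.payoffScale_nonneg
  have hnoise := abs_dotProduct_le_card_mul (hconc a) (hf.abs_reward_sub_le hx)
  have hsq : √((actionCount a h : ℝ) + 1) * √((actionCount a h : ℝ) + 1) = actionCount a h + 1 :=
    Real.mul_self_sqrt (by positivity)
  set q := √((actionCount a h : ℝ) + 1)
  have hq : 1 ≤ q := Real.one_le_sqrt.2 (by simp)
  have hnum : |(fun s => outcomeDeviation M.P a s h) ⬝ᵥ (M.reward - x) - M.utility a x| ≤
      p.payoffScale S * (confidenceRadius h.length + 1) * q :=
    calc _ ≤ Fintype.card S * (confidenceRadius h.length * q * (p.rewardBound + p.eta)) +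
          p.payoffScale S :=
          (abs_sub _ _).trans (add_le_add hnoise (hf.abs_utility_le a hx))
      _ = p.payoffScale S * (confidenceRadius h.length * q) + p.payoffScale S * 1 := by
          rw [payoffScale]; ring
      _ ≤ p.payoffScale S * (confidenceRadius h.length * q) + p.payoffScale S * q := by gcongr
      _ = p.payoffScale S * (confidenceRadius h.length + 1) * q := by ring
  rw [hh.empiricalUtility_sub_utility, ← hsq, abs_div, abs_of_pos (by positivity : 0 < q * q),
    ← div_div, width]
  exact div_le_div_of_nonneg_right ((div_le_iff₀ (by positivity)).2 hnum) (by positivity)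

theorem Fits.utility_le_index (hf : p.Fits M β) (hh : M.IsHistory β p.learner h)
    (hconc : IsConcentrated M.P h) {π : ContractPlan A S} (hπ : π.goal ∈ contractSpace S p.eta) :
    M.utility π.target π.goal ≤ p.index h π := by
  unfold index
  linarith [abs_le.1 (hf.abs_empiricalUtility_sub_le hh hconc π.target hπ)]

theorem Fits.index_le_utility_add (hf : p.Fits M β) (hh : M.IsHistory β p.learner h)
    (hconc : IsConcentrated M.P h) {π : ContractPlan A S} (hπ : π.goal ∈ contractSpace S p.eta) :
    p.index h π ≤ M.utility π.target π.goal + 2 * p.width h π.target := by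
  unfold index
  linarith [abs_le.1 (hf.abs_empiricalUtility_sub_le hh hconc π.target hπ)]

end Confidence

section RoundRegret

theorem IsAdmissible.utility_point_ge {π : ContractPlan A S} (hπ : p.IsAdmissible h π) (t : ℕ) :
    M.utility π.target π.goal - p.eta * slack t ≤ M.utility π.target (π.point (1 - slack t)) := by
  have hbase := dotProduct_mem_Icc (M.P_mem π.target) hπ.base_mem.1
  have hgoal := dotProduct_mem_Icc (M.P_mem π.target) hπ.goal_mem
  have hdiff := mul_le_mul_of_nonneg_left
    (show M.P π.target ⬝ᵥ π.base - M.P π.target ⬝ᵥ π.goal ≤ p.eta by linarith [hbase.2, hgoal.1])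
    (slack_pos t).le
  unfold ContractualBandit.utility
  rw [ContractPlan.dotProduct_point]
  linarith

variable [Nonempty A]

theorem Fits.width_nonneg (hf : p.Fits M β) (h : List (Round A S)) (a : A) : 0 ≤ p.width h a :=
  div_nonneg (mul_nonneg hf.payoffScale_nonneg
    (add_nonneg (confidenceRadius_nonneg _) zero_le_one)) (by positivity)

theorem Fits.inducedValue_le_one (hf : p.Fits M β) (a : A) : M.inducedValue p.eta a ≤ 1 :=
  ContractualBandit.inducedValue_le (hf.inducingContracts_nonempty a) fun _ hx =>
    (ContractualBandit.utility_mem a hx.1).2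

section Optimism

variable [Finite A]

/-- Optimism: every pair of an action and a contract that induces it is available as a plan. -/
theorem Fits.inducedValue_le_index_plan (hf : p.Fits M β) (hh : M.IsHistory β p.learner h)
    (hlen : (probes S p.eta).card ≤ h.length) (hconc : IsConcentrated M.P h) (a : A) :
    M.inducedValue p.eta a ≤ p.index h (p.plan h) + slack h.length := by
  refine ContractualBandit.inducedValue_le (hf.inducingContracts_nonempty a) fun x hx => ?_
  obtain ⟨π, hπ, rfl, rfl⟩ := hf.exists_isAdmissible hh hlen hx
  exact (hf.utility_le_index hh hconc hπ.goal_mem).trans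
    ((hf.isNearOptimal_plan hh hlen).index_le π hπ)

theorem Fits.inducedValue_sub_utility_point_le (hf : p.Fits M β) (hh : M.IsHistory β p.learner h)
    (hlen : (probes S p.eta).card ≤ h.length) (hconc : IsConcentrated M.P h) (a : A) :
    M.inducedValue p.eta a -
        M.utility (p.plan h).target ((p.plan h).point (1 - slack h.length)) ≤
      (1 + p.eta) * slack h.length + 2 * p.width h (p.plan h).target := by
  have hplan := (hf.isNearOptimal_plan hh hlen).admissible
  linarith [hf.inducedValue_le_index_plan hh hlen hconc a,
    hf.index_le_utility_add hh hconc hplan.goal_mem,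
    hplan.utility_point_ge (M := M) h.length]

end Optimism

variable [Fintype A]

open Classical in
theorem Fits.inducedValue_sub_utility_le (hf : p.Fits M β) (hh : M.IsHistory β p.learner h)
    (a : A) {ρ : Round A S} (hρ : ρ.contract = p.learner h) :
    M.inducedValue p.eta a - M.utility ρ.action ρ.contract ≤
      (1 + p.eta) * ((if p.IsLost h ρ then 1 else 0) + (penalty M.P h.length h + slack h.length)) +
        2 * p.width h ρ.action := by
  have hη := p.eta_pos
  have hpenalty := penalty_nonneg M.P h.length h
  have hslack := (slack_pos h.length).le
  have hwidth := hf.width_nonneg h ρ.action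
  have hsafe : M.inducedValue p.eta a - M.utility ρ.action ρ.contract ≤ 1 + p.eta := by
    have hutility := (ContractualBandit.utility_mem (M := M) ρ.action (p.learner_mem h)).1
    rw [hρ]
    linarith [hf.inducedValue_le_one a]
  have hbad : ∀ u, 1 ≤ u → M.inducedValue p.eta a - M.utility ρ.action ρ.contract ≤
      (1 + p.eta) * u + 2 * p.width h ρ.action := fun u hu => by
    linarith [mul_le_mul_of_nonneg_left hu (by linarith : 0 ≤ 1 + p.eta)]
  by_cases hlost : p.IsLost h ρ
  · exact hbad _ (by rw [if_pos hlost]; linarith)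
  by_cases hconc : IsConcentrated M.P h
  · obtain ⟨hlen, hnone, htarget⟩ : (probes S p.eta).card ≤ h.length ∧
        p.search h = none ∧ ρ.action = (p.plan h).target := by
      simpa only [IsLost, not_or, not_lt, Option.not_isSome_iff_eq_none, not_not] using hlost
    have hgood := hf.inducedValue_sub_utility_point_le hh hlen hconc a
    rw [← learner_eq_point hnone hlen (hf.isNearOptimal_plan hh hlen).admissible, ← htarget,
      ← hρ] at hgood
    refine hgood.trans (add_le_add_left (mul_le_mul_of_nonneg_left ?_ (by linarith)) _)
    rw [if_neg hlost]
    linarith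
  · have hlarge := one_le_penalty M.P_mem hconc
    exact hbad _ (by rw [if_neg hlost]; linarith)

end RoundRegret

section CumulativeRegret

variable [Fintype A] [Nonempty A]

theorem Fits.width_le (hf : p.Fits M β) {T : ℕ} (hT : h.length ≤ T) (ρ : Round A S) :
    p.width h ρ.action ≤ p.payoffScale S * (confidenceRadius T + 1) *
      (countPotential (h ++ [ρ]) - countPotential h) := by
  have hscale := hf.payoffScale_nonneg
  have hradius := confidenceRadius_nonneg T
  calc p.width h ρ.action
      ≤ p.payoffScale S * (confidenceRadius T + 1) *
          (1 / √((actionCount ρ.action h : ℝ) + 1)) := by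
        rw [width, div_eq_mul_one_div]
        gcongr
        exact confidenceRadius_mono hT
    _ ≤ _ := by
        gcongr
        exact one_div_sqrt_actionCount_add_one_le h ρ

theorem Fits.sum_inducedValue_sub_utility_le (hf : p.Fits M β) {T : ℕ}
    (hh : M.IsHistory β p.learner h) (hT : h.length ≤ T) (a : A) :
    (h.map fun ρ => M.inducedValue p.eta a - M.utility ρ.action ρ.contract).sum ≤
      (1 + p.eta) * (p.lostRounds h + totalPenalty M.P h.length h) +
        2 * (p.payoffScale S * (confidenceRadius T + 1) * countPotential h) := by
  classical
  induction hh with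
  | nil => simp [lostRounds_nil, totalPenalty, countPotential_nil]
  | @concat h _ s ih =>
    rw [List.length_append, List.length_singleton] at hT ⊢
    set ρ : Round A S := ⟨p.learner h, β (p.learner h), s, M.reward s⟩
    have hround := hf.inducedValue_sub_utility_le ‹_› a (ρ := ρ) rfl
    have hwidth := hf.width_le ((Nat.le_succ _).trans hT) ρ
    have hpast := ih ((Nat.le_succ _).trans hT)
    rw [List.map_append, List.sum_append, List.map_singleton, List.sum_singleton,
      totalPenalty_concat, lostRounds_concat]
    push_cast
    linarith

theorem Fits.regret_le (hf : p.Fits M β) (hh : M.IsHistory β p.learner h) :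
    M.regret p.eta h ≤
      (1 + p.eta) * ((probes S p.eta).card +
        (Nat.log 2 (h.length + 1) + 1) ^ 2 * p.searchFactor S + totalPenalty M.P h.length h) +
      4 * (p.payoffScale S * Fintype.card A) * (confidenceRadius h.length + 1) * √h.length := by
  have hη := p.eta_pos
  have hscale := hf.payoffScale_nonneg
  have hradius := confidenceRadius_nonneg h.length
  have hlost : (p.lostRounds h : ℝ) ≤
      (probes S p.eta).card + (Nat.log 2 (h.length + 1) + 1) ^ 2 * p.searchFactor S := by
    exact_mod_cast hf.lostRounds_le hh
  rw [ContractualBandit.regret, sub_le_iff_le_add]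
  refine ciSup_le fun a => ?_
  have hsplit : (h.map fun _ => M.inducedValue p.eta a).sum =
      (h.map fun ρ => M.inducedValue p.eta a - M.utility ρ.action ρ.contract).sum +
        (h.map fun ρ => M.utility ρ.action ρ.contract).sum := by
    rw [← List.sum_map_add]
    simp only [sub_add_cancel]
  refine hsplit.trans_le (add_le_add ?_ le_rfl)
  calc _ ≤ (1 + p.eta) * (p.lostRounds h + totalPenalty M.P h.length h) +
          2 * (p.payoffScale S * (confidenceRadius h.length + 1) * countPotential h) :=
        hf.sum_inducedValue_sub_utility_le hh le_rfl a
    _ ≤ (1 + p.eta) * ((probes S p.eta).card +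
          (Nat.log 2 (h.length + 1) + 1) ^ 2 * p.searchFactor S + totalPenalty M.P h.length h) +
          2 * (p.payoffScale S * (confidenceRadius h.length + 1) *
            (2 * Fintype.card A * √h.length)) := by
        gcongr
        exact countPotential_le h
    _ = _ := by ring

theorem Fits.expectedRegret_le_confidenceRadius (hf : p.Fits M β) (T : ℕ) :
    M.expectedRegret p.eta β p.learner T ≤
      (1 + p.eta) * ((probes S p.eta).card +
        (Nat.log 2 (T + 1) + 1) ^ 2 * p.searchFactor S +
          (2 * Fintype.card A * Fintype.card S + 1) * (2 * √T)) +
      4 * (p.payoffScale S * Fintype.card A) * (confidenceRadius T + 1) * √T := by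
  have hη := p.eta_pos
  have hsuper : M.IsSupersolution β p.learner fun h => (1 + p.eta) *
      ((probes S p.eta).card + (Nat.log 2 (T + 1) + 1) ^ 2 * p.searchFactor S +
        totalPenalty M.P T h) +
      4 * (p.payoffScale S * Fintype.card A) * (confidenceRadius T + 1) * √T :=
    .add (.const_mul (by positivity) (.add (.const _) (isSupersolution_totalPenalty _ T)))
      (.const _)
  refine (hsuper.expectAfter_le T .nil fun g hg hlen => ?_).trans ?_
  · rw [List.length_nil, zero_add] at hlen
    subst hlen
    exact hf.regret_le hg
  · gcongr
    exact totalPenalty_nil_le M.P T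

/-- The constant of the regret bound. -/
noncomputable def regretConstant (p : PublicInfo A) (S : Type*) [Fintype S] : ℝ :=
  (1 + p.eta) * (4 * (probes S p.eta).card + 36 * p.searchFactor S +
    8 * (2 * Fintype.card A * Fintype.card S + 1)) + 144 * (p.payoffScale S * Fintype.card A)

theorem Fits.expectedRegret_le (hf : p.Fits M β) {T : ℕ} (hT : 2 ≤ T) :
    M.expectedRegret p.eta β p.learner T ≤ p.regretConstant S * √T * Real.log T ^ 2 := by
  have hη := p.eta_pos
  have hscale := hf.payoffScale_nonneg
  have hlog := one_le_two_mul_log hT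
  have hdyadic := nat_log_add_one_le hT
  have hsqrt : 1 ≤ √(T : ℝ) := Real.one_le_sqrt.2 (by exact_mod_cast one_le_two.trans hT)
  have hradius : confidenceRadius T + 1 ≤ 36 * Real.log T ^ 2 := by
    nlinarith [confidenceRadius_add_one_le hT]
  set l := Real.log T
  have hsq : 1 ≤ 4 * l ^ 2 := by nlinarith
  calc M.expectedRegret p.eta β p.learner T
      ≤ (1 + p.eta) * ((probes S p.eta).card * 1 +
          (Nat.log 2 (T + 1) + 1) ^ 2 * p.searchFactor S * 1 +
            (2 * Fintype.card A * Fintype.card S + 1) * (2 * √T) * 1) +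
        4 * (p.payoffScale S * Fintype.card A) * (confidenceRadius T + 1) * √T := by
        simpa only [mul_one] using hf.expectedRegret_le_confidenceRadius T
    _ ≤ (1 + p.eta) * ((probes S p.eta).card * (4 * l ^ 2 * √T) +
          (6 * l) ^ 2 * p.searchFactor S * √T +
            (2 * Fintype.card A * Fintype.card S + 1) * (2 * √T) * (4 * l ^ 2)) +
        4 * (p.payoffScale S * Fintype.card A) * (36 * l ^ 2) * √T := by
        gcongr
        exact one_le_mul_of_one_le_of_one_le hsq hsqrt
    _ = p.regretConstant S * √T * l ^ 2 := by rw [regretConstant]; ring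

end CumulativeRegret

end PublicInfo

theorem mainTheorem5 :
    ∃ k : ℕ, ∀ (A : Type*) (S : Type*) [Fintype A] [Nonempty A] [Fintype S]
      (η lam B : ℝ) (c : A → ℝ), 0 < lam → (∀ a a', c a - c a' < lam * η) →
      ∃ (C : ℝ) (alg : LearningAlgorithm A S), (∀ h, alg h ∈ contractSpace S η) ∧
        ∀ M : ContractualBandit A S, M.cost = c → M.Inducible lam → (∀ s, |M.reward s| ≤ B) →
          ∀ β : (S → ℝ) → A, M.IsBestResponse η β →
            ∀ T : ℕ, 2 ≤ T →
              M.expectedRegret η β alg T ≤ C * Real.sqrt T * Real.log T ^ k := by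
  refine ⟨2, fun A S _ _ _ η lam B c hlam hcost => ?_⟩
  let p : PublicInfo A := ⟨η, lam, B, c, hlam, hcost⟩
  exact ⟨p.regretConstant S, p.learner, p.learner_mem, fun M hc hind hB β hβ T hT =>
    PublicInfo.Fits.expectedRegret_le (p := p) ⟨hc, hind, hB, hβ⟩ hT⟩
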